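/- **Theorem 4.5.** Let $p$ be a prime, let $R=\mathbb Z_{p^\alpha}$, let $n\ge 1$, and let $C\subseteq R^n$ be a linear code (a submodule). Positions and times are taken in $\{0,\dots,n-1\}$ modulo $n$. *$p$-bases.* A $p$-linear combination is one with coefficients in $\{0,\dots,p-1\}$. A sequence $v_1,\dots,v_k$ in $R^n$ is $p$-linearly independent if each $pv_i$ is a $p$-linear combination of $v_{i+1},\dots,v_k$ and $0$ is not a nontrivial $p$-linear combination of the $v_i$; it is a $p$-basis of $C$ if moreover $C$ is the set of its $p$-linear combinations. Then $k$ is the $p$-dimension of $C$. A $p$-basis is biproper if any two members that start (respectively end) at the same position have non-associate first (respectively last) nonzero components. It is in row echelon form if each earlier member starts before each later one, or starts at the same position with a first nonzero component of higher order. *Characteristic generators.* Let $\sigma_j$ be the cyclic shift to the left by $j$ places. For each $j\in\{0,\dots,n-1\}$ choose a biproper $p$-basis $Y_j$ of $\sigma_j(C)$ in row echelon form. Each $y\in Y_j$, with first and last nonzero positions $s$ and $e$, gives the word $x=\sigma_j^{-1}(y)\in C$ with the span $[x]=(a,b]=(s+j,e+j]$ (a cyclic semiopen interval, empty if $a=b$)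 and the orders of $x_a$ and $x_b$. The choices are made so that generators with the same span and the same two orders coincide. The resulting set $X$ is called a set of characteristic generators for $C$. *Trellises.* A tail-biting trellis $T$ of length $n$ over $R$ consists of finite vertex classes $V_0,\dots,V_{n-1}$ and sets $E_i\subseteq V_i\times R\times V_{i+1}$ of labelled edges ($i$ modulo $n$). It represents the set of edge-label sequences of its cycles $v_0\to v_1\to\dots\to v_{n-1}\to v_0$. It is linear if the $V_i$ can be given $R$-module structures for which the set of all pairs (vertex sequence, label sequence) of such cycles is a submodule of $\prod_i V_i\times R^n$. A trellis $T$ for $C$ (that is, one representing $C$) is minimal under $\prec_\Theta$ if no trellis $T'$ for $C$ satisfies $|V'_i|\le|V_i|$ for all $i$ with at least one strict inequality. In a product of trellises, vertex classes are Cartesian products, and tuples of edges are edges labelled by the sum of the labels. For $x\in R^n$ with span $(a,b]$, the elementary trellis $T_x$ has vertices $0,\dots,p-1$ at the times in $(a,b]$ and the single vertex $0$ at the other times; its edges at time $i$ are, for $0\le m<p$, the edges labelled $m x_i$ from $m$ (or $0$ if $i\notin(a,b]$) to $m$ (or $0$ if $i+1\notin(a,b]$). *Claim.* Let $C$ have $p$-dimension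 $k$, and let $T$ be a linear tail-biting trellis for $C$ that is minimal under $\prec_\Theta$. Then there are a set $X$ of characteristic generators for $C$ and $k$ $p$-linearly independent elements $z_1,\dots,z_k$ of $X$ such that $$T\cong T_{z_1}\times T_{z_2}\times\dots\times T_{z_k},$$ where $T_{z_i}$ is formed with the span of the characteristic generator $z_i$, and $\cong$ means bijections of the vertex classes $V_i$ preserving labelled edges in both directions. -/

import Mathlib

namespace TailBiting

/-- The closed cyclic interval `[a, b]` of the circular time axis `{0, …, n-1}`: the times
`a, a+1, …, b` if `a ≤ b`, and `a, …, n-1, 0, …, b` if `a > b`. -/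
def cyclicIcc {n : ℕ} (a b : Fin n) : Set (Fin n) :=
  {i | (a ≤ b ∧ a ≤ i ∧ i ≤ b) ∨ (b < a ∧ (a ≤ i ∨ i ≤ b))}

/-- The semiopen cyclic interval `(a, b] = [a, b] \ {a}`; in particular `(a, a]` is empty. -/
def cyclicIoc {n : ℕ} (a b : Fin n) : Set (Fin n) :=
  cyclicIcc a b \ {a}

/-! ### Tail-biting trellises -/

/-- A (finite) tail-biting trellis of length `n ≥ 1` over the alphabet `A`. `V i` is the vertex
class at time `i`, and `E i` is the set of labelled edges from `V i` to `V (i + 1)`, where `i + 1`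
is taken modulo `n`. A conventional trellis is the special case in which `V 0` has one vertex
(its first and last vertices being identified). -/
structure Trellis (n : ℕ) [NeZero n] (A : Type) where
  V : Fin n → Type
  finite : ∀ i, Finite (V i)
  E : ∀ i, Set (V i × A × V (i + 1))

namespace Trellis

variable {n : ℕ} [NeZero n] {A : Type}

/-- The label code of a trellis: all pairs consisting of the vertex sequence and the edge-label
sequence of a cycle of length `n` that starts in `V 0`. -/
def labelCode (T : Trellis n A) : Set ((∀ i, T.V i) × (Fin n → A)) :=
  {s | ∀ i, (s.1 i, s.2 i, s.1 (i + 1)) ∈ T.E i}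

/-- The code represented by a trellis: the edge-label sequences of its cycles. -/
def code (T : Trellis n A) : Set (Fin n → A) :=
  {c | ∃ v : ∀ i, T.V i, (v, c) ∈ T.labelCode}

/-- The vertex-class profile `(|V 0|, …, |V (n-1)|)`. -/
noncomputable def profile (T : Trellis n A) (i : Fin n) : ℕ :=
  Nat.card (T.V i)

/-- The strict vertex-profile order `T' ≺ T`. -/
def ProfileLT (T' T : Trellis n A) : Prop :=
  (∀ i, T'.profile i ≤ T.profile i) ∧ ∃ i, T'.profile i < T.profile i

/-- `T` is a trellis for `C` that is minimal under the vertex-profile order: no trellis for `C`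
whatsoever is strictly smaller. -/
def IsMinimalFor (T : Trellis n A) (C : Set (Fin n → A)) : Prop :=
  T.code = C ∧ ¬ ∃ T' : Trellis n A, T'.code = C ∧ ProfileLT T' T

/-- `T` is linear over the ring `R`: its vertices can be labelled by elements of `R`-modules
in such a way that the label code is `R`-linear. -/
def IsLinear {R : Type} [CommRing R] (T : Trellis n R) : Prop :=
  ∃ (_ : ∀ i, AddCommGroup (T.V i)) (_ : ∀ i, Module R (T.V i)),
    ∃ S : Submodule R ((∀ i, T.V i) × (Fin n → R)),
      (S : Set ((∀ i, T.V i) × (Fin n → R))) = T.labelCode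

/-- Isomorphism of trellises: bijections between the vertex classes that respect all labelled
edges in both directions. -/
def Isomorphic (T T' : Trellis n A) : Prop :=
  ∃ φ : ∀ i, T.V i ≃ T'.V i, ∀ (i : Fin n) (v : T.V i) (c : A) (v' : T.V (i + 1)),
    (v, c, v') ∈ T.E i ↔ (φ i v, c, φ (i + 1) v') ∈ T'.E i

/-- The product `T₁ × ⋯ × Tₖ`: vertex classes are Cartesian products, and an edge is a tuple of
edges of the factors, labelled by the sum of their labels. -/
def product [AddCommMonoid A] {k : ℕ} (T : Fin k → Trellis n A) : Trellis n A where
  V i := ∀ m, (T m).V i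
  finite i := by
    have := fun m => (T m).finite i
    infer_instance
  E i := {e | ∃ c : Fin k → A,
    (∀ m, (e.1 m, c m, e.2.2 m) ∈ (T m).E i) ∧ e.2.1 = ∑ m, c m}

end Trellis

/-- The elementary trellis of the word `x` with span `(a, b]`, with respect to the prime `p`.
It has the `p` vertices `0, …, p-1` at the times in `(a, b]` and the single vertex `0` at the
other times. The edges at time `i` come from the multiples `m x` with `0 ≤ m < p`: the edge
of `m x` has label `m xᵢ`, and each of its two ends is the vertex `m` if the time of this end lies
in `(a, b]`, and the vertex `0` otherwise. Thus vertices `v ∈ V i` and `v' ∈ V (i + 1)` are joined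
if and only if `i = a`, or `i = b`, or `v = v'`. -/
def elementary {n : ℕ} [NeZero n] {R : Type} [CommRing R] (p : ℕ) (x : Fin n → R)
    (a b : Fin n) : Trellis n R where
  V i := {v : Fin p // i ∉ cyclicIoc a b → (v : ℕ) = 0}
  finite _ := inferInstance
  E i := {e | ∃ m : Fin p, (i ∈ cyclicIoc a b → e.1.1 = m) ∧
    (i + 1 ∈ cyclicIoc a b → e.2.2.1 = m) ∧ e.2.1 = (m : ℕ) • x i}

/-! ### `p`-bases -/

section PBases

variable {M : Type} [AddCommGroup M] {k : ℕ}

/-- The set of `p`-linear combinations (coefficients in `{0, …, p-1}`) of `v₀, …, v_{k-1}`. -/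
def pSpan (p : ℕ) (v : Fin k → M) : Set M :=
  {x | ∃ d : Fin k → ℕ, (∀ j, d j < p) ∧ x = ∑ j, d j • v j}

/-- An ordered sequence is a `p`-generator sequence if `p` times each member is a `p`-linear
combination of the members after it (so `p` times the last one vanishes). -/
def IsPGeneratorSequence (p : ℕ) (v : Fin k → M) : Prop :=
  ∀ i, ∃ d : Fin k → ℕ, (∀ j, d j < p) ∧ p • v i = ∑ j ∈ Finset.Ioi i, d j • v j

/-- A `p`-generator sequence is `p`-linearly independent if `0` is not a nontrivial `p`-linear
combination of its members. -/
def PLinearlyIndependent (p : ℕ) (v : Fin k → M) : Prop :=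
  IsPGeneratorSequence p v ∧
    ∀ d : Fin k → ℕ, (∀ j, d j < p) → ∑ j, d j • v j = 0 → ∀ j, d j = 0

/-- `v` is a `p`-basis of the set `C`. -/
def IsPBasis (p : ℕ) (C : Set M) (v : Fin k → M) : Prop :=
  PLinearlyIndependent p v ∧ pSpan p v = C

/-- `C` has `p`-dimension `k`. -/
def HasPDimension (p : ℕ) (C : Set M) (k : ℕ) : Prop :=
  ∃ v : Fin k → M, IsPBasis p C v

end PBases

/-! ### Biproper `p`-bases in row echelon form -/

section Words

variable {n : ℕ} {R : Type} [CommRing R]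

/-- `s` is the position of the first nonzero component of `x`. -/
def StartsAt (x : Fin n → R) (s : Fin n) : Prop :=
  x s ≠ 0 ∧ ∀ i, i < s → x i = 0

/-- `e` is the position of the last nonzero component of `x`. -/
def EndsAt (x : Fin n → R) (e : Fin n) : Prop :=
  x e ≠ 0 ∧ ∀ i, e < i → x i = 0

/-- Any two members start at different positions, or have starting components which are not
associates. -/
def IsProper {k : ℕ} (v : Fin k → Fin n → R) : Prop :=
  ∀ i j, i ≠ j → ∀ s, StartsAt (v i) s → StartsAt (v j) s → ¬ Associated (v i s) (v j s)

/-- Any two members end at different positions, or have ending components which are not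
associates. -/
def IsCoproper {k : ℕ} (v : Fin k → Fin n → R) : Prop :=
  ∀ i j, i ≠ j → ∀ e, EndsAt (v i) e → EndsAt (v j) e → ¬ Associated (v i e) (v j e)

/-- Row echelon form: each earlier member starts at an earlier position than each later one,
or at the same position with a starting component of higher additive order. -/
def IsRowEchelon {k : ℕ} (v : Fin k → Fin n → R) : Prop :=
  ∀ i j, i < j → ∀ s t, StartsAt (v i) s → StartsAt (v j) t →
    s < t ∨ (s = t ∧ addOrderOf (v j t) < addOrderOf (v i s))

/-- `v` is a biproper `p`-basis of `C` in row echelon form. -/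
def IsBiproperPBasis (p : ℕ) (C : Set (Fin n → R)) {k : ℕ} (v : Fin k → Fin n → R) : Prop :=
  IsPBasis p C v ∧ IsProper v ∧ IsCoproper v ∧ IsRowEchelon v

variable [NeZero n]

/-- The cyclic shift `σⱼ` to the left by `j` places: `σⱼ(x) = (x_j, x_{j+1}, …, x_{j-1})`. -/
def shiftLeft (j : Fin n) (x : Fin n → R) : Fin n → R :=
  fun i => x (i + j)

/-- The triple `(x, a, b)`, that is, the word `x` with its span `(a, b]`, is obtained from the
family of sequences `Y₀, …, Y_{n-1}`: for some `j`, the word `σⱼ(x)` is a member `y` of `Yⱼ`, and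
`(a, b]` is the conventional span of `y` moved back by `j`. (The other two entries of a
characteristic generator, the orders of `x_a` and `x_b`, are determined by `x`, `a` and `b`.) -/
def IsGeneratorOf {k : ℕ} (Y : Fin n → Fin k → Fin n → R) (x : Fin n → R) (a b : Fin n) : Prop :=
  ∃ (j : Fin n) (m : Fin k) (s e : Fin n), shiftLeft j x = Y j m ∧
    StartsAt (Y j m) s ∧ EndsAt (Y j m) e ∧ a = s + j ∧ b = e + j

/-- A family `Y₀, …, Y_{n-1}` that defines a set of characteristic generators of `C`: each `Yⱼ` is
a biproper `p`-basis in row echelon form of the shifted code `σⱼ(C)`, and the same representative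
is used whenever the same span and orders occur, so that the resulting set contains exactly one
generator for each span `(a, b]` and pair of orders that occur. -/
def IsCharacteristicFamily (p : ℕ) (C : Set (Fin n → R)) {k : ℕ}
    (Y : Fin n → Fin k → Fin n → R) : Prop :=
  (∀ j, IsBiproperPBasis p (shiftLeft j '' C) (Y j)) ∧
    ∀ x x' a b, IsGeneratorOf Y x a b → IsGeneratorOf Y x' a b →
      addOrderOf (x a) = addOrderOf (x' a) → addOrderOf (x b) = addOrderOf (x' b) → x = x'

end Words

end TailBiting

set_option linter.unusedSectionVars false

namespace TailBiting

/-! ### `p`-linear combinations in modules over `ZMod (p ^ α)`: coverage, uniqueness, counting -/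

section PCombinations

variable {p α : ℕ} [Fact p.Prime] {M : Type} [AddCommGroup M] [Module (ZMod (p ^ α)) M]

/-! The paths of `T` form a finite module `S`. For each cyclic arc let `arcPaths` be the submodule
of paths living on that arc. An arc of `m + 1` edges has two subarcs of `m` edges; adjoin to the sum
of their path modules elements of order `p` modulo their predecessors until all paths on the arc are
reached. Let `N` be the number of elements adjoined over all arcs. Inclusion-exclusion telescopes
along the arcs with a common start, so that `p ^ N` is the product over all times of the number of
edges on paths divided by the number of vertices. Since edge sequences that close up lie in `S`,
this is at most `|S|` (`prod_card_arcPaths_le`, `exists_arcGenerators`).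

Minimality enters a first time through `le_iSup_arcPaths`: paths through a zero vertex span `S`,
since otherwise vertices at time `0` could be saved. So the `p`-linear combinations of the `N`
generators cover `S`, and by the bound on `p ^ N` they are unique. Vertices and edges of `T` are
then coefficient sequences, and `T` is the product of the elementary trellises of the label words `x
j` (`isomorphic_arcProduct`).

Minimality enters a second time for these words (`IsMinimalArcFamily`): no word can be exchanged for
one on a proper subarc, since the product trellis would shrink. Exchange arguments yield that the `x
j` are `p`-linearly independent, that no `x j` is a sum of words of `C` on its two maximal subarcs
(`notMem_sup`), and hence that `x j` is shortest among the words with its start and order of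
starting component, with at most one member for each such pair.

Finally, for every start and order choose one shortest word, taking `x j` where it qualifies. In
each shift of `C` the chosen words that start there, in echelon order, are a `p`-basis; it is
biproper because cancelling a common end would produce a shorter word (`exists_isBiproperPBasis`).
The choice does not depend on the shift, so these bases define one set of characteristic generators,
and it contains all `x j`. -/

theorem pow_nsmul_eq_zero (x : M) : p ^ α • x = 0 := by
  rw [← Nat.cast_smul_eq_nsmul (ZMod (p ^ α)), ZMod.natCast_self, zero_smul]

/-- A multiple of `x` that is not divisible by `p` generates the same submodule as `x`. -/
theorem mem_of_nsmul_mem {N : Submodule (ZMod (p ^ α)) M} {x : M} {d : ℕ} (h0 : d ≠ 0)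
    (hd : d < p) (h : d • x ∈ N) : x ∈ N := by
  have hc : d.Coprime (p ^ α) :=
    (Nat.coprime_of_lt_prime h0 hd (Fact.out : p.Prime)).symm.pow_right α |>.symm.symm
  have := N.smul_mem (((ZMod.unitOfCoprime d hc)⁻¹ : (ZMod (p ^ α))ˣ) : ZMod (p ^ α)) h
  rwa [← Nat.cast_smul_eq_nsmul (ZMod (p ^ α)), smul_smul, ← ZMod.coe_unitOfCoprime d hc,
    Units.inv_mul, one_smul] at this

theorem smul_eq_val_nsmul (c : ZMod (p ^ α)) (x : M) : c • x = c.val • x := by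
  rw [← Nat.cast_smul_eq_nsmul (ZMod (p ^ α)), ZMod.natCast_zmod_val]

theorem smul_eq_mod_add (c : ZMod (p ^ α)) (x : M) :
    c • x = (c.val % p) • x + (c.val / p) • (p • x) := by
  rw [smul_eq_val_nsmul, smul_smul, ← add_smul, mul_comm, Nat.mod_add_div]

variable {ι : Type} [Fintype ι]

/-- If `p` times each member of a family is spanned by members of lower rank, then its span
consists of `p`-linear combinations. -/
theorem exists_pCombination (D : Set ι) (ρ : ι → ℕ) (x : ι → M)
    (h : ∀ i ∈ D, p • x i ∈ Submodule.span (ZMod (p ^ α)) (x '' {m | m ∈ D ∧ ρ m < ρ i}))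
    {y : M} (hy : y ∈ Submodule.span (ZMod (p ^ α)) (x '' D)) :
    ∃ d : ι → ℕ, (∀ j, d j < p) ∧ (∀ j, j ∉ D → d j = 0) ∧ y = ∑ j, d j • x j := by
  classical
  have hp : 0 < p := (Fact.out : p.Prime).pos
  have key : ∀ t : ℕ, ∀ y ∈ Submodule.span (ZMod (p ^ α)) (x '' {m | m ∈ D ∧ ρ m < t}),
      ∃ d : ι → ℕ, (∀ j, d j < p) ∧ (∀ j, ¬ (j ∈ D ∧ ρ j < t) → d j = 0) ∧
        y = ∑ j, d j • x j := by
    intro t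
    induction t with
    | zero =>
      intro y hy
      refine ⟨fun _ => 0, fun _ => hp, fun _ _ => rfl, ?_⟩
      simpa using hy
    | succ t ih =>
      intro y hy
      -- Reduce the coefficients of rank `t` modulo `p`; what is left over are multiples of `p • x
      -- j`, which have lower rank.
      have hy' : ∃ e : ι → ℕ, (∀ j, e j < p) ∧ (∀ j, ¬ (j ∈ D ∧ ρ j = t) → e j = 0) ∧
          y - ∑ j, e j • x j ∈
            Submodule.span (ZMod (p ^ α)) (x '' {m | m ∈ D ∧ ρ m < t}) := by
        rw [Finsupp.mem_span_image_iff_linearCombination] at hy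
        obtain ⟨c, hc, rfl⟩ := hy
        rw [Finsupp.linearCombination_apply, Finsupp.sum_fintype _ _ (by simp)]
        refine ⟨fun j => if j ∈ D ∧ ρ j = t then (c j).val % p else 0, fun j => ?_,
          fun j hj => if_neg hj, ?_⟩
        · dsimp only
          split_ifs
          exacts [Nat.mod_lt _ hp, hp]
        · rw [← Finset.sum_sub_distrib]
          refine Submodule.sum_mem _ fun j _ => ?_
          dsimp only
          split_ifs with hj
          · rw [smul_eq_mod_add, add_sub_cancel_left]
            have := h j hj.1
            rw [hj.2] at this
            exact nsmul_mem this _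
          · by_cases h0 : c j = 0
            · simp [h0]
            · rw [zero_smul, sub_zero]
              refine Submodule.smul_mem _ _ (Submodule.subset_span ⟨j, ?_, rfl⟩)
              have hm := hc (Finsupp.mem_support_iff.2 h0)
              exact ⟨hm.1, lt_of_le_of_ne (Nat.lt_succ_iff.1 hm.2) fun h => hj ⟨hm.1, h⟩⟩
      obtain ⟨e, he, he0, hy'⟩ := hy'
      obtain ⟨d, hd, hd0, hyd⟩ := ih _ hy'
      refine ⟨fun j => if ρ j = t then e j else d j, fun j => ?_, fun j hj => ?_, ?_⟩
      · dsimp only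
        split_ifs
        exacts [he j, hd j]
      · dsimp only
        split_ifs with h1
        · exact he0 j fun h2 => hj ⟨h2.1, by omega⟩
        · exact hd0 j fun h2 => hj ⟨h2.1, by omega⟩
      · rw [sub_eq_iff_eq_add, ← Finset.sum_add_distrib] at hyd
        rw [hyd]
        refine Finset.sum_congr rfl fun j _ => ?_
        dsimp only
        split_ifs with h1
        · rw [hd0 j (by omega), zero_smul, zero_add]
        · rw [he0 j (by tauto), zero_smul, add_zero]
  obtain ⟨t, ht⟩ : ∃ t, ∀ i, ρ i < t :=
    ⟨Finset.univ.sup ρ + 1, fun i => Nat.lt_succ_of_le (Finset.le_sup (Finset.mem_univ i))⟩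
  obtain ⟨d, hd, hd0, hyd⟩ := key t y (by simpa [ht] using hy)
  exact ⟨d, hd, fun j hj => hd0 j fun h => hj h.1, hyd⟩

/-- Two `p`-linear combinations of the family agree only if their coefficients do. -/
def PUnique (p : ℕ) (x : ι → M) : Prop :=
  ∀ d e : ι → ℕ, (∀ j, d j < p) → (∀ j, e j < p) → ∑ j, d j • x j = ∑ j, e j • x j → d = e

theorem card_pCombinations (p : ℕ) : Nat.card (ι → Fin p) = p ^ Fintype.card ι := by
  rw [Nat.card_fun, Nat.card_fin, Nat.card_eq_fintype_card]

/-- If there are no more coefficient sequences than elements, then `p`-linear combinations are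
unique as soon as they cover everything. -/
theorem pUnique_of_card_le [Finite M] {N : Submodule (ZMod (p ^ α)) M} {x : ι → M}
    (hx : ∀ i, x i ∈ N)
    (hcov : ∀ y ∈ N, ∃ d : ι → ℕ, (∀ j, d j < p) ∧ y = ∑ j, d j • x j)
    (hcard : p ^ Fintype.card ι ≤ Nat.card N) : PUnique p x := by
  let f : (ι → Fin p) → N := fun d =>
    ⟨∑ j, (d j : ℕ) • x j, Submodule.sum_mem _ fun j _ => nsmul_mem (hx j) _⟩
  have hf : Function.Surjective f := by
    rintro ⟨y, hy⟩
    obtain ⟨d, hd, rfl⟩ := hcov y hy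
    exact ⟨fun j => ⟨d j, hd j⟩, rfl⟩
  have hb := hf.bijective_of_nat_card_le (by rwa [card_pCombinations])
  intro d e hd he hde
  have := hb.1 (a₁ := fun j => ⟨d j, hd j⟩) (a₂ := fun j => ⟨e j, he j⟩) (Subtype.ext hde)
  funext j
  exact congrArg Fin.val (congrFun this j)

theorem card_eq_of_pUnique {N : Submodule (ZMod (p ^ α)) M} {x : ι → M}
    (hx : ∀ i, x i ∈ N)
    (hcov : ∀ y ∈ N, ∃ d : ι → ℕ, (∀ j, d j < p) ∧ y = ∑ j, d j • x j)
    (hu : PUnique p x) : Nat.card N = p ^ Fintype.card ι := by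
  let f : (ι → Fin p) → N := fun d =>
    ⟨∑ j, (d j : ℕ) • x j, Submodule.sum_mem _ fun j _ => nsmul_mem (hx j) _⟩
  have hf : Function.Surjective f := by
    rintro ⟨y, hy⟩
    obtain ⟨d, hd, rfl⟩ := hcov y hy
    exact ⟨fun j => ⟨d j, hd j⟩, rfl⟩
  have hi : Function.Injective f := by
    intro d e hde
    have := hu (fun j => d j) (fun j => e j) (fun j => (d j).2) (fun j => (e j).2)
      (congrArg Subtype.val hde)
    funext j
    exact Fin.ext (congrFun this j)
  rw [← card_pCombinations p, Nat.card_congr (Equiv.ofBijective f ⟨hi, hf⟩)]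

theorem card_le_of_pCombinations {N : Submodule (ZMod (p ^ α)) M} {x : ι → M} (D : Finset ι)
    (hx : ∀ i ∈ D, x i ∈ N)
    (hcov : ∀ y ∈ N, ∃ d : ι → ℕ, (∀ j, d j < p) ∧ (∀ j, j ∉ D → d j = 0) ∧
      y = ∑ j, d j • x j) : Nat.card N ≤ p ^ D.card := by
  have hs : ∀ d : ι → ℕ, (∀ j, j ∉ D → d j = 0) → ∑ j, d j • x j = ∑ j : D, d j • x j := by
    intro d hd
    rw [Finset.sum_coe_sort D fun j => d j • x j]
    refine (Finset.sum_subset (Finset.subset_univ _) fun j _ hj => ?_).symm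
    rw [hd j hj, zero_smul]
  let f : (D → Fin p) → N := fun d =>
    ⟨∑ j, (d j : ℕ) • x j, Submodule.sum_mem _ fun j _ => nsmul_mem (hx j j.2) _⟩
  have hf : Function.Surjective f := by
    rintro ⟨y, hy⟩
    obtain ⟨d, hd, hd0, rfl⟩ := hcov y hy
    exact ⟨fun j => ⟨d j, hd j⟩, Subtype.ext (hs d hd0).symm⟩
  have := Nat.card_le_card_of_surjective f hf
  rwa [card_pCombinations, Fintype.card_coe] at this

/-- The multiples `d • b` with `d < p` represent the cosets of `A` in the sum. They are distinct
because a difference is a multiple of `b` prime to `p`, which cannot lie in `A` unless `b` does. -/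
theorem card_sup_span_singleton {A : Submodule (ZMod (p ^ α)) M} {b : M} (hb : b ∉ A)
    (hpb : p • b ∈ A) :
    Nat.card (A ⊔ Submodule.span (ZMod (p ^ α)) {b} : Submodule _ M) = p * Nat.card A := by
  have hp : 0 < p := (Fact.out : p.Prime).pos
  let f : Fin p × A → (A ⊔ Submodule.span (ZMod (p ^ α)) {b} : Submodule _ M) := fun q =>
    ⟨q.2 + (q.1 : ℕ) • b, Submodule.add_mem_sup q.2.2
      (nsmul_mem (Submodule.mem_span_singleton_self b) _)⟩
  have key : ∀ (d e : Fin p) (a a' : M), d ≤ e → a ∈ A → a' ∈ A →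
      a + (d : ℕ) • b = a' + (e : ℕ) • b → d = e := by
    intro d e a a' hde ha ha' h
    by_contra hne
    have hlt : (d : ℕ) < e := lt_of_le_of_ne hde fun h => hne (Fin.ext h)
    refine hb (mem_of_nsmul_mem (d := (e : ℕ) - d) (by omega) (by omega) ?_)
    have : ((e : ℕ) - d) • b = a - a' := by
      have h2 : (e : ℕ) • b = ((e : ℕ) - d) • b + (d : ℕ) • b := by
        rw [← add_smul, Nat.sub_add_cancel hlt.le]
      rw [h2, ← add_assoc] at h
      rw [eq_sub_iff_add_eq, add_comm]
      exact (add_right_cancel h).symm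
    rw [this]
    exact A.sub_mem ha ha'
  have hf : Function.Bijective f := by
    constructor
    · rintro ⟨d, a⟩ ⟨e, a'⟩ h
      have h' : (a : M) + (d : ℕ) • b = a' + (e : ℕ) • b := congrArg Subtype.val h
      have hde : d = e := by
        rcases le_total d e with hle | hle
        · exact key d e a a' hle a.2 a'.2 h'
        · exact (key e d a' a hle a'.2 a.2 h'.symm).symm
      subst hde
      simpa using h'
    · rintro ⟨y, hy⟩
      obtain ⟨a, ha, z, hz, rfl⟩ := Submodule.mem_sup.1 hy
      obtain ⟨c, rfl⟩ := Submodule.mem_span_singleton.1 hz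
      refine ⟨(⟨c.val % p, Nat.mod_lt _ hp⟩, ⟨a + (c.val / p) • (p • b),
        A.add_mem ha (nsmul_mem hpb _)⟩), Subtype.ext ?_⟩
      simp only [f]
      rw [smul_eq_mod_add c b]
      abel
  rw [← Nat.card_congr (Equiv.ofBijective f hf), Nat.card_prod, Nat.card_fin]

/-- Since `p ^ α` kills the module, the multiples `p ^ e • b` of an element outside `A` enter `A`;
the last one outside is the required element. -/
theorem exists_notMem_nsmul_mem {A B : Submodule (ZMod (p ^ α)) M} (h : ¬ B ≤ A) :
    ∃ b ∈ B, b ∉ A ∧ p • b ∈ A := by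
  classical
  obtain ⟨b, hb, hbA⟩ := SetLike.not_le_iff_exists.1 h
  have hex : ∃ e, p ^ e • b ∈ A := ⟨α, by rw [pow_nsmul_eq_zero]; exact A.zero_mem⟩
  have h0 : Nat.find hex ≠ 0 := fun h => hbA (by simpa [h] using Nat.find_spec hex)
  refine ⟨p ^ (Nat.find hex - 1) • b, nsmul_mem hb _, Nat.find_min hex (by omega), ?_⟩
  rw [smul_smul, ← pow_succ', Nat.sub_add_cancel (by omega)]
  exact Nat.find_spec hex

/-- A submodule `B` is obtained from a smaller one `A` by adjoining elements, one after the
other, each of which has order `p` modulo what is already there. -/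
theorem exists_chain [Finite M] {A B : Submodule (ZMod (p ^ α)) M} (hAB : A ≤ B) :
    ∃ (t : ℕ) (g : Fin t → M), (∀ i, g i ∈ B) ∧
      (∀ i, p • g i ∈ A ⊔ Submodule.span (ZMod (p ^ α)) (g '' {m | m < i})) ∧
      B ≤ A ⊔ Submodule.span (ZMod (p ^ α)) (Set.range g) ∧
      p ^ t * Nat.card A = Nat.card B := by
  induction A using WellFoundedGT.induction with
  | ind A ih =>
  by_cases hBA : B ≤ A
  · exact ⟨0, Fin.elim0, fun i => i.elim0, fun i => i.elim0, hBA.trans le_sup_left,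
      by rw [le_antisymm hAB hBA, pow_zero, one_mul]⟩
  · obtain ⟨b, hb, hbA, hpb⟩ := exists_notMem_nsmul_mem hBA
    have hlt : A < A ⊔ Submodule.span (ZMod (p ^ α)) {b} := by
      refine lt_of_le_of_ne le_sup_left fun h => hbA ?_
      rw [h]
      exact Submodule.mem_sup_right (Submodule.mem_span_singleton_self b)
    obtain ⟨t, g, hgB, hg, hcov, hcard⟩ := ih _ hlt (sup_le hAB (by simpa using hb))
    refine ⟨t + 1, Fin.cons b g, ?_, ?_, ?_, ?_⟩
    · exact Fin.cases hb hgB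
    · refine Fin.cases (Submodule.mem_sup_left hpb) fun i => ?_
      have : A ⊔ Submodule.span (ZMod (p ^ α)) {b} ⊔
          Submodule.span (ZMod (p ^ α)) (g '' {m | m < i}) ≤ A ⊔ Submodule.span (ZMod (p ^ α))
            ((Fin.cons b g : Fin (t + 1) → M) '' {m | m < i.succ}) := by
        refine sup_le (sup_le le_sup_left ?_) ?_
        · refine le_trans (Submodule.span_mono ?_) le_sup_right
          rintro _ rfl
          exact ⟨0, Fin.succ_pos i, rfl⟩
        · refine le_trans (Submodule.span_mono ?_) le_sup_right
          rintro _ ⟨m, hm, rfl⟩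
          exact ⟨m.succ, Fin.succ_lt_succ_iff.2 hm, rfl⟩
      exact this (hg i)
    · refine hcov.trans (sup_le (sup_le le_sup_left ?_) ?_)
      · refine le_trans (Submodule.span_mono ?_) le_sup_right
        rintro _ rfl
        exact ⟨0, rfl⟩
      · refine le_trans (Submodule.span_mono ?_) le_sup_right
        rintro _ ⟨m, rfl⟩
        exact ⟨m.succ, rfl⟩
    · rw [← hcard, card_sup_span_singleton hbA hpb]
      ring

/-- Elements of equal additive order are multiples of each other. -/
theorem exists_mul_of_addOrderOf_eq {N : ℕ} [NeZero N] {x y : ZMod N}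
    (h : addOrderOf x = addOrderOf y) : ∃ c : ZMod N, x = c * y := by
  classical
  -- A cyclic group has at most `o` elements killed by `o`, so an element of order `o` generates all
  -- of them.
  have hsub : ∀ z : ZMod N, addOrderOf z = addOrderOf y →
      (Finset.univ.filter (· ∈ AddSubgroup.zmultiples z)) =
        Finset.univ.filter (fun g : ZMod N => addOrderOf y • g = 0) := by
    intro z hz
    refine Finset.eq_of_subset_of_card_le (fun g hg => ?_) ?_
    · obtain ⟨m, rfl⟩ := (Finset.mem_filter.1 hg).2
      refine Finset.mem_filter.2 ⟨Finset.mem_univ _, ?_⟩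
      change addOrderOf y • m • z = 0
      rw [smul_comm, ← hz, addOrderOf_nsmul_eq_zero, smul_zero]
    · refine (IsAddCyclic.card_nsmul_eq_zero_le (addOrderOf_pos y)).trans ?_
      rw [← hz, ← Nat.card_zmultiples, ← Fintype.card_subtype, Nat.card_eq_fintype_card]
  have hx : x ∈ AddSubgroup.zmultiples y := by
    have : x ∈ Finset.univ.filter (· ∈ AddSubgroup.zmultiples y) := by
      rw [hsub y rfl, ← hsub x h]
      exact Finset.mem_filter.2 ⟨Finset.mem_univ _, AddSubgroup.mem_zmultiples x⟩
    exact (Finset.mem_filter.1 this).2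
  obtain ⟨m, rfl⟩ := hx
  exact ⟨m, by simp⟩

end PCombinations

/-! ### Cardinality forms of the isomorphism theorems -/

section Card

variable {R M N : Type} [Ring R] [AddCommGroup M] [Module R M] [AddCommGroup N] [Module R N]

theorem card_ker_mul_card_range (f : M →ₗ[R] N) :
    Nat.card (LinearMap.ker f) * Nat.card (LinearMap.range f) = Nat.card M := by
  rw [Submodule.card_eq_card_quotient_mul_card (LinearMap.ker f),
    Nat.card_congr f.quotKerEquivRange.toEquiv, mul_comm]

theorem card_sup_mul_card_inf (A B : Submodule R M) :
    Nat.card (A ⊔ B : Submodule R M) * Nat.card (A ⊓ B : Submodule R M) =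
      Nat.card A * Nat.card B := by
  have h1 := Submodule.card_eq_card_quotient_mul_card (Submodule.comap A.subtype (A ⊓ B))
  have h2 := Submodule.card_eq_card_quotient_mul_card (Submodule.comap (A ⊔ B).subtype B)
  have h3 := Nat.card_congr (LinearMap.quotientInfEquivSupQuotient A B).toEquiv
  rw [← Submodule.comap_inf] at h3
  have h4 := Nat.card_congr (Submodule.comapSubtypeEquivOfLe (inf_le_left : A ⊓ B ≤ A)).toEquiv
  have h5 := Nat.card_congr (Submodule.comapSubtypeEquivOfLe (le_sup_right : B ≤ A ⊔ B)).toEquiv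
  rw [h1, h2, h3, h4, h5]
  ring

end Card

/-! ### Arcs of the circular time axis, described by offsets from their start -/

section Arcs

variable {n : ℕ} [NeZero n]

theorem sub_add_one_val (a i : Fin n) :
    ((i - a : Fin n) : ℕ) = (((i - (a + 1) : Fin n) : ℕ) + 1) % n := by
  have h : i - a = (i - (a + 1)) + 1 := by abel
  rw [h, Fin.val_add, Fin.val_one', Nat.add_mod_mod]

theorem add_one_sub_val (a i : Fin n) :
    ((i + 1 - a : Fin n) : ℕ) = (((i - a : Fin n) : ℕ) + 1) % n := by
  have h : i + 1 - a = (i - a) + 1 := by abel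
  rw [h, Fin.val_add, Fin.val_one', Nat.add_mod_mod]

theorem sub_val_eq_zero {a i : Fin n} : ((i - a : Fin n) : ℕ) = 0 ↔ i = a := by
  rw [Fin.val_eq_zero_iff, sub_eq_zero]

/-- The offset of `i` from `a`, in terms of the one from `a + 1`. -/
theorem offset_cases (a i : Fin n) :
    (((i - a : Fin n) : ℕ) = ((i - (a + 1) : Fin n) : ℕ) + 1 ∧ ((i - a : Fin n) : ℕ) < n) ∨
      (((i - a : Fin n) : ℕ) = 0 ∧ ((i - (a + 1) : Fin n) : ℕ) + 1 = n) := by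
  have h := sub_add_one_val a i
  have h1 := (i - (a + 1)).isLt
  rcases Nat.lt_or_ge (((i - (a + 1) : Fin n) : ℕ) + 1) n with h2 | h2
  · rw [Nat.mod_eq_of_lt h2] at h
    exact Or.inl ⟨h, by omega⟩
  · have h3 : ((i - (a + 1) : Fin n) : ℕ) + 1 = n := by omega
    rw [h3, Nat.mod_self] at h
    exact Or.inr ⟨h, h3⟩

/-- The inner vertex times of the arc of `l` edges that starts at time `a`. -/
def arcTimes (a : Fin n) (l : ℕ) : Set (Fin n) :=
  {i | 1 ≤ ((i - a : Fin n) : ℕ) ∧ ((i - a : Fin n) : ℕ) < l}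

theorem arcTimes_mono (a : Fin n) {l l' : ℕ} (h : l ≤ l') : arcTimes a l ⊆ arcTimes a l' :=
  fun _ hi => ⟨hi.1, hi.2.trans_le h⟩

theorem arcTimes_succ_subset (a : Fin n) {l : ℕ} (hl : l < n) :
    arcTimes (a + 1) l ⊆ arcTimes a (l + 1) := by
  rintro i ⟨h1, h2⟩
  rcases offset_cases a i with h3 | h3
  · exact ⟨by omega, by omega⟩
  · omega

theorem notMem_arcTimes {a i : Fin n} {l : ℕ} :
    i ∉ arcTimes a l ↔ ((i - a : Fin n) : ℕ) = 0 ∨ l ≤ ((i - a : Fin n) : ℕ) := by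
  simp only [arcTimes, Set.mem_ofPred_eq]
  omega

end Arcs

/-! ### Paths supported on arcs, and the local count of edges and vertices -/

section Paths

variable {n : ℕ} [NeZero n] {R : Type} [CommRing R] {V : Fin n → Type}
  [∀ i, AddCommGroup (V i)] [∀ i, Module R (V i)]

/-- The members of `S` all of whose nonzero vertices and labels lie on the arc of `l` edges that
starts at time `a`. -/
def arcPaths (S : Submodule R ((∀ i, V i) × (Fin n → R))) (a : Fin n) (l : ℕ) :
    Submodule R ((∀ i, V i) × (Fin n → R)) where
  carrier := {s | s ∈ S ∧ ∀ i, (i ∉ arcTimes a l → s.1 i = 0) ∧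
    (l ≤ ((i - a : Fin n) : ℕ) → s.2 i = 0)}
  add_mem' := by
    rintro s s' ⟨h1, h2⟩ ⟨h3, h4⟩
    refine ⟨S.add_mem h1 h3, fun i => ⟨fun hi => ?_, fun hi => ?_⟩⟩
    · simp [(h2 i).1 hi, (h4 i).1 hi]
    · simp [(h2 i).2 hi, (h4 i).2 hi]
  zero_mem' := ⟨S.zero_mem, by simp⟩
  smul_mem' := by
    rintro c s ⟨h1, h2⟩
    refine ⟨S.smul_mem c h1, fun i => ⟨fun hi => ?_, fun hi => ?_⟩⟩
    · simp [(h2 i).1 hi]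
    · simp [(h2 i).2 hi]

variable (S : Submodule R ((∀ i, V i) × (Fin n → R)))

theorem arcPaths_le (a : Fin n) (l : ℕ) : arcPaths S a l ≤ S := fun _ h => h.1

theorem arcPaths_mono (a : Fin n) {l l' : ℕ} (h : l ≤ l') : arcPaths S a l ≤ arcPaths S a l' :=
  fun _ hs => ⟨hs.1, fun i => ⟨fun hi => (hs.2 i).1 fun hi' => hi (arcTimes_mono a h hi'),
    fun hi => (hs.2 i).2 (h.trans hi)⟩⟩

theorem arcPaths_succ_le (a : Fin n) {l : ℕ} (hl : l < n) :
    arcPaths S (a + 1) l ≤ arcPaths S a (l + 1) :=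
  fun _ hs => ⟨hs.1, fun i => ⟨fun hi => (hs.2 i).1 fun hi' => hi (arcTimes_succ_subset a hl hi'),
    fun hi => (hs.2 i).2 (by rcases offset_cases a i with h | h <;> omega)⟩⟩

theorem arcPaths_zero (a : Fin n) : arcPaths S a 0 = ⊥ := by
  refine eq_bot_iff.2 fun s hs => ?_
  refine (Submodule.mem_bot _).2 (Prod.ext (funext fun i => ?_) (funext fun i => ?_))
  · exact (hs.2 i).1 fun h => absurd h.2 (Nat.not_lt_zero _)
  · exact (hs.2 i).2 (Nat.zero_le _)

theorem mem_arcPaths_length {a : Fin n} {s : (∀ i, V i) × (Fin n → R)} :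
    s ∈ arcPaths S a n ↔ s ∈ S ∧ s.1 a = 0 := by
  refine ⟨fun h => ⟨h.1, (h.2 a).1 (notMem_arcTimes.2 (Or.inl (by simp)))⟩,
    fun h => ⟨h.1, fun i => ⟨fun hi => ?_, fun hi => absurd (i - a).isLt (not_lt.2 hi)⟩⟩⟩
  rcases notMem_arcTimes.1 hi with h' | h'
  · rw [sub_val_eq_zero.1 h']
    exact h.2
  · exact absurd (i - a).isLt (not_lt.2 h')

/-- The bound `l < n` is needed: only then does the last edge of the second arc not meet the first
edge of the first arc around the circle, so that the two arcs overlap in a single arc. -/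
theorem arcPaths_inf (a : Fin n) {l : ℕ} (hl : l < n) :
    arcPaths S a l ⊓ arcPaths S (a + 1) l = arcPaths S (a + 1) (l - 1) := by
  rcases Nat.eq_zero_or_pos l with rfl | hpos
  · simp [arcPaths_zero]
  refine le_antisymm ?_ (le_inf ?_ (arcPaths_mono S _ (Nat.sub_le _ _)))
  · rintro s ⟨h1, h2⟩
    refine ⟨h1.1, fun i => ⟨fun hi => ?_, fun hi => ?_⟩⟩
    · by_cases h : i ∈ arcTimes a l
      · refine (h2.2 i).1 fun h' => hi ⟨h'.1, ?_⟩
        have := h.2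
        rcases offset_cases a i with h3 | h3
        · omega
        · exact absurd h.1 (by omega)
      · exact (h1.2 i).1 h
    · rcases offset_cases a i with h3 | h3
      · exact (h1.2 i).2 (by omega)
      · exact (h2.2 i).2 (by omega)
  · have := arcPaths_succ_le S a (l := l - 1) (by omega)
    rwa [Nat.sub_add_cancel hpos] at this

/-- `c m` is the index of the paths split over the two subarcs of `m` edges. By `arcPaths_inf` the
size of that sum is a quotient of sizes of arc modules, so the product of the indices telescopes. At
`L = 0` the truncated `L - 1` is harmless, as both modules are zero. -/
theorem prod_mul_card_arcPaths [∀ i, Finite (V i)] [Finite R] (a : Fin n) (c : ℕ → ℕ)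
    (hc : ∀ m < n, c m * Nat.card (arcPaths S a m ⊔ arcPaths S (a + 1) m : Submodule R _) =
      Nat.card (arcPaths S a (m + 1))) {L : ℕ} (hL : L ≤ n) :
    (∏ m ∈ Finset.range L, c m) * Nat.card (arcPaths S (a + 1) (L - 1)) =
      Nat.card (arcPaths S a L) := by
  induction L with
  | zero => simp [arcPaths_zero]
  | succ L ih =>
    have ih := ih (by omega)
    have h1 := hc L (by omega)
    have h2 := card_sup_mul_card_inf (arcPaths S a L) (arcPaths S (a + 1) L)
    rw [arcPaths_inf S a (by omega)] at h2
    have hpos : 0 < Nat.card (arcPaths S (a + 1) (L - 1)) := Nat.card_pos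
    refine Nat.eq_of_mul_eq_mul_right hpos ?_
    rw [Finset.prod_range_succ, Nat.add_sub_cancel, ← h1, mul_assoc (c L), h2, ← ih]
    ring

/-- The set of sequences that satisfy the local constraints has at least as many elements as
the local constraints allow for. -/
theorem prod_card_arcPaths_le [∀ i, Finite (V i)] [Finite R]
    (hS : ∀ s : (∀ i, V i) × (Fin n → R),
      (∀ i, ∃ s' ∈ S, s'.1 i = s.1 i ∧ s'.2 i = s.2 i ∧ s'.1 (i + 1) = s.1 (i + 1)) → s ∈ S)
    (hV : ∀ i (v : V i), ∃ s ∈ S, s.1 i = v) :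
    ∏ i, Nat.card (arcPaths S i n) ≤
      Nat.card S * ∏ i : Fin n, Nat.card (arcPaths S (i + 1) (n - 1)) := by
  let ev : ∀ i, S →ₗ[R] V i := fun i => LinearMap.proj i ∘ₗ LinearMap.fst R _ _ ∘ₗ S.subtype
  let ed : ∀ i, S →ₗ[R] V i × R × V (i + 1) := fun i =>
    (ev i).prod ((LinearMap.proj i ∘ₗ LinearMap.snd R _ _ ∘ₗ S.subtype).prod (ev (i + 1)))
  have hev : ∀ i, Nat.card (arcPaths S i n) * Nat.card (V i) = Nat.card S := by
    intro i
    rw [← card_ker_mul_card_range (ev i)]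
    congr 1
    · refine Nat.card_congr ⟨fun s => ⟨⟨s, s.2.1⟩, ((mem_arcPaths_length S).1 s.2).2⟩,
        fun s => ⟨s, (mem_arcPaths_length S).2 ⟨s.1.2, s.2⟩⟩, fun _ => rfl, fun _ => rfl⟩
    · have : LinearMap.range (ev i) = ⊤ := by
        refine LinearMap.range_eq_top.2 fun v => ?_
        obtain ⟨s, hs, rfl⟩ := hV i v
        exact ⟨⟨s, hs⟩, rfl⟩
      rw [this]
      exact Nat.card_congr (Submodule.topEquiv (R := R)).symm.toEquiv
  -- The arc of `n - 1` edges that starts at `i + 1` omits exactly the edge at time `i`.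
  have hker : ∀ (i : Fin n) (s : S),
      s ∈ LinearMap.ker (ed i) ↔ (s : (∀ i, V i) × (Fin n → R)) ∈ arcPaths S (i + 1) (n - 1) := by
    intro i s
    have hoff : ∀ j : Fin n, ((j - (i + 1) : Fin n) : ℕ) + 1 = n ↔ j = i := by
      intro j
      rw [← sub_val_eq_zero]
      rcases offset_cases i j with h | h <;> omega
    rw [LinearMap.mem_ker]
    constructor
    · intro h
      have h1 : s.1.1 i = 0 := congrArg Prod.fst h
      have h2 : s.1.2 i = 0 := congrArg (fun q => q.2.1) h
      have h3 : s.1.1 (i + 1) = 0 := congrArg (fun q => q.2.2) h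
      refine ⟨s.2, fun j => ⟨fun hj => ?_, fun hj => ?_⟩⟩
      · rcases notMem_arcTimes.1 hj with h' | h'
        · rw [sub_val_eq_zero.1 h', h3]
        · have := (hoff j).1 (by have := (j - (i + 1)).isLt; omega)
          rw [this, h1]
      · have := (hoff j).1 (by have := (j - (i + 1)).isLt; omega)
        rw [this, h2]
    · intro h
      have h0 := (hoff i).2 rfl
      refine Prod.ext ?_ (Prod.ext ?_ ?_)
      · exact (h.2 i).1 (notMem_arcTimes.2 (Or.inr (by omega)))
      · exact (h.2 i).2 (by omega)
      · exact (h.2 (i + 1)).1 (notMem_arcTimes.2 (Or.inl (by simp)))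
  have hed : ∀ i : Fin n, Nat.card (arcPaths S (i + 1) (n - 1)) *
      Nat.card (LinearMap.range (ed i)) =
      Nat.card S := by
    intro i
    rw [← card_ker_mul_card_range (ed i)]
    congr 1
    exact Nat.card_congr ⟨fun s => ⟨⟨s, s.2.1⟩, (hker i _).2 s.2⟩,
        fun s => ⟨s, (hker i _).1 s.2⟩, fun _ => rfl, fun _ => rfl⟩
  -- `Φ` measures the mismatch between the end of each edge and the beginning of the next. Its
  -- kernel consists of the edge sequences that close up, and these come from members of `S`.
  let Φ : (∀ i, LinearMap.range (ed i)) →ₗ[R] (∀ i, V (i + 1)) := LinearMap.pi fun i =>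
    (LinearMap.snd R _ _ ∘ₗ LinearMap.snd R _ _ ∘ₗ (LinearMap.range (ed i)).subtype ∘ₗ
      LinearMap.proj i) -
    (LinearMap.fst R _ _ ∘ₗ (LinearMap.range (ed (i + 1))).subtype ∘ₗ LinearMap.proj (i + 1))
  have hΦ : ∀ e, e ∈ LinearMap.ker Φ → ∀ i, (e i).1.2.2 = (e (i + 1)).1.1 := by
    intro e he i
    have := congrFun (LinearMap.mem_ker.1 he) i
    exact sub_eq_zero.1 this
  have hkerΦ : Nat.card (LinearMap.ker Φ) ≤ Nat.card S := by
    have hmem : ∀ e ∈ LinearMap.ker Φ,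
        ((fun i => (e i).1.1, fun i => (e i).1.2.1) : (∀ i, V i) × (Fin n → R)) ∈ S := by
      intro e he
      refine hS _ fun i => ?_
      obtain ⟨s, hs⟩ := (e i).2
      refine ⟨s, s.2, congrArg Prod.fst hs, congrArg (fun q => q.2.1) hs, ?_⟩
      exact (congrArg (fun q => q.2.2) hs).trans (hΦ e he i)
    refine Nat.card_le_card_of_injective (fun e : LinearMap.ker Φ => (⟨_, hmem e.1 e.2⟩ : S)) ?_
    intro e e' h
    have h1 : ∀ i, (e.1 i).1.1 = (e'.1 i).1.1 :=
      congrFun (congrArg (fun s : S => s.1.1) h)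
    have h2 : ∀ i, (e.1 i).1.2.1 = (e'.1 i).1.2.1 :=
      congrFun (congrArg (fun s : S => s.1.2) h)
    refine Subtype.ext (funext fun i => Subtype.ext (Prod.ext (h1 i) (Prod.ext (h2 i) ?_)))
    rw [hΦ _ e.2, hΦ _ e'.2, h1]
  have hE : ∏ i, Nat.card (LinearMap.range (ed i)) ≤ Nat.card S * ∏ i, Nat.card (V i) := by
    rw [← Nat.card_pi, ← card_ker_mul_card_range Φ]
    refine Nat.mul_le_mul hkerΦ ?_
    refine (Nat.card_le_card_of_injective _ Subtype.val_injective).trans ?_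
    rw [Nat.card_pi]
    exact le_of_eq (Equiv.prod_comp (Equiv.addRight (1 : Fin n)) fun i => Nat.card (V i))
  have h1 : (∏ i, Nat.card (arcPaths S i n)) * ∏ i, Nat.card (V i) = Nat.card S ^ n := by
    rw [← Finset.prod_mul_distrib, Finset.prod_congr rfl fun i _ => hev i]
    simp
  have h2 : (∏ i : Fin n, Nat.card (arcPaths S (i + 1) (n - 1))) *
      ∏ i, Nat.card (LinearMap.range (ed i)) = Nat.card S ^ n := by
    rw [← Finset.prod_mul_distrib, Finset.prod_congr rfl fun i _ => hed i]
    simp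
  have hpos : 0 < ∏ i, Nat.card (V i) := Finset.prod_pos fun i _ => Nat.card_pos
  refine Nat.le_of_mul_le_mul_right ?_ hpos
  rw [h1, ← h2]
  calc _ ≤ _ := Nat.mul_le_mul_left _ hE
    _ = _ := by ring

end Paths

/-! ### Generators of the path module, arc by arc -/

section Generators

variable {p α n : ℕ} [Fact p.Prime] [NeZero n] {V : Fin n → Type}
  [∀ i, AddCommGroup (V i)] [∀ i, Module (ZMod (p ^ α)) (V i)] [∀ i, Finite (V i)]
  (S : Submodule (ZMod (p ^ α)) ((∀ i, V i) × (Fin n → ZMod (p ^ α))))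

/-- The paths that are needed to span `S`, with their arcs: they are listed by decreasing length
of the arcs, and on each arc `p` times a generator is spanned by later generators on subarcs. -/
theorem exists_arcGenerators
    (hS : ∀ s : (∀ i, V i) × (Fin n → ZMod (p ^ α)),
      (∀ i, ∃ s' ∈ S, s'.1 i = s.1 i ∧ s'.2 i = s.2 i ∧ s'.1 (i + 1) = s.1 (i + 1)) → s ∈ S)
    (hV : ∀ i (v : V i), ∃ s ∈ S, s.1 i = v) :
    ∃ (N : ℕ) (g : Fin N → (∀ i, V i) × (Fin n → ZMod (p ^ α))) (a : Fin N → Fin n)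
      (l : Fin N → ℕ), (∀ j, 1 ≤ l j ∧ l j ≤ n) ∧ (∀ j, g j ∈ arcPaths S (a j) (l j)) ∧
      (∀ j m, j ≤ m → l m ≤ l j) ∧
      (∀ j, p • g j ∈ Submodule.span (ZMod (p ^ α))
        (g '' {m | j < m ∧ arcTimes (a m) (l m) ⊆ arcTimes (a j) (l j)})) ∧
      (∀ i, arcPaths S i n ≤ Submodule.span (ZMod (p ^ α))
        (g '' {m | i ∉ arcTimes (a m) (l m)})) ∧
      p ^ N ≤ Nat.card S := by
  have hle : ∀ (a : Fin n) (m : Fin n),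
      arcPaths S a m ⊔ arcPaths S (a + 1) m ≤ arcPaths S a (m + 1) := fun a m =>
    sup_le (arcPaths_mono S a (Nat.le_succ _)) (arcPaths_succ_le S a m.isLt)
  choose t g hgB hg hcov hcard using fun a m => exists_chain (hle a m)
  let ι := Σ q : Fin n × Fin n, Fin (t q.1 q.2)
  let G : ι → (∀ i, V i) × (Fin n → ZMod (p ^ α)) := fun q => g q.1.1 q.1.2 q.2
  let A : ι → Set (Fin n) := fun q => arcTimes q.1.1 (q.1.2 + 1)
  let ρ : ι → ℕ ×ₗ ℕ := fun q => toLex ((q.1.2 : ℕ), (q.2 : ℕ))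
  let W : Fin n → ℕ → Submodule (ZMod (p ^ α)) ((∀ i, V i) × (Fin n → ZMod (p ^ α))) :=
    fun a l => Submodule.span (ZMod (p ^ α))
      (G '' {q | (q.1.2 : ℕ) < l ∧ A q ⊆ arcTimes a l})
  have hspan : ∀ l ≤ n, ∀ a, arcPaths S a l ≤ W a l := by
    intro l
    induction l with
    | zero => intro _ a; rw [arcPaths_zero]; exact bot_le
    | succ l ih =>
      intro hl a
      refine (hcov a ⟨l, by omega⟩).trans (sup_le (sup_le ?_ ?_) ?_)
      · refine (ih (by omega) a).trans (Submodule.span_mono (Set.image_mono ?_))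
        exact fun q hq => ⟨hq.1.trans (Nat.lt_succ_self l),
          hq.2.trans (arcTimes_mono a (Nat.le_succ l))⟩
      · refine (ih (by omega) (a + 1)).trans (Submodule.span_mono (Set.image_mono ?_))
        exact fun q hq => ⟨hq.1.trans (Nat.lt_succ_self l),
          hq.2.trans (arcTimes_succ_subset a (by omega))⟩
      · refine Submodule.span_mono ?_
        rintro _ ⟨i, rfl⟩
        exact ⟨⟨(a, ⟨l, by omega⟩), i⟩, ⟨Nat.lt_succ_self l, subset_rfl⟩, rfl⟩
  have hpG : ∀ q : ι, p • G q ∈ Submodule.span (ZMod (p ^ α))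
      (G '' {q' | ρ q' < ρ q ∧ A q' ⊆ A q}) := by
    rintro ⟨⟨a, m⟩, i⟩
    refine SetLike.le_def.1 (sup_le (sup_le ?_ ?_) ?_) (hg a m i)
    · refine (hspan m m.isLt.le a).trans (Submodule.span_mono (Set.image_mono ?_))
      exact fun q hq => ⟨Prod.Lex.toLex_lt_toLex.2 (Or.inl hq.1),
        hq.2.trans (arcTimes_mono a (Nat.le_succ m))⟩
    · refine (hspan m m.isLt.le (a + 1)).trans (Submodule.span_mono (Set.image_mono ?_))
      exact fun q hq => ⟨Prod.Lex.toLex_lt_toLex.2 (Or.inl hq.1),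
        hq.2.trans (arcTimes_succ_subset a m.isLt)⟩
    · refine Submodule.span_mono ?_
      rintro _ ⟨i', hi', rfl⟩
      exact ⟨⟨(a, m), i'⟩, ⟨Prod.Lex.toLex_lt_toLex.2 (Or.inr ⟨rfl, hi'⟩), subset_rfl⟩, rfl⟩
  -- For each start `a` the generator counts telescope to the quotient of `|arcPaths S a n|` by
  -- `|arcPaths S (a + 1) (n - 1)|`; the local count bounds the product of these quotients.
  have hN : p ^ Fintype.card ι ≤ Nat.card S := by
    have h1 : p ^ Fintype.card ι = ∏ a, ∏ m ∈ Finset.range n,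
        if h : m < n then p ^ t a ⟨m, h⟩ else 1 := by
      rw [Fintype.card_sigma, ← Finset.prod_pow_eq_pow_sum, Fintype.prod_prod_type]
      refine Finset.prod_congr rfl fun a _ => ?_
      rw [Finset.prod_range]
      exact Finset.prod_congr rfl fun m _ => by simp
    have h2 : ∀ a, (∏ m ∈ Finset.range n, if h : m < n then p ^ t a ⟨m, h⟩ else 1) *
        Nat.card (arcPaths S (a + 1) (n - 1)) = Nat.card (arcPaths S a n) := by
      intro a
      refine prod_mul_card_arcPaths S a _ (fun m hm => ?_) le_rfl
      rw [dif_pos hm]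
      exact hcard a ⟨m, hm⟩
    have h3 := prod_card_arcPaths_le S hS hV
    rw [← Finset.prod_congr rfl fun a _ => h2 a, Finset.prod_mul_distrib, ← h1] at h3
    exact Nat.le_of_mul_le_mul_right h3 (Finset.prod_pos fun i _ => Nat.card_pos)
  let e0 := Fintype.equivFin ι
  -- The dual order lists high ranks first: long arcs come early, and on one arc the elements
  -- adjoined last come first.
  let f : Fin (Fintype.card ι) → (ℕ ×ₗ ℕ)ᵒᵈ := fun j => OrderDual.toDual (ρ (e0.symm j))
  let e : Fin (Fintype.card ι) ≃ ι := (Tuple.sort f).trans e0.symm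
  have he : ∀ j m, j ≤ m → ρ (e m) ≤ ρ (e j) := fun j m h => Tuple.monotone_sort f h
  have himg : ∀ P : ι → Prop, (G ∘ e) '' {m | P (e m)} = G '' {q | P q} := by
    intro P
    ext x
    constructor
    · rintro ⟨m, hm, rfl⟩
      exact ⟨e m, hm, rfl⟩
    · rintro ⟨q, hq, rfl⟩
      exact ⟨e.symm q, by simpa using hq, by simp⟩
  refine ⟨Fintype.card ι, G ∘ e, fun j => (e j).1.1, fun j => (e j).1.2 + 1,
    fun j => ⟨Nat.le_add_left _ _, (e j).1.2.isLt⟩, fun j => hgB _ _ _, fun j m h => ?_,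
    fun j => ?_, fun i => ?_, hN⟩
  · rcases Prod.Lex.toLex_le_toLex.1 (he j m h) with h | h
    · exact Nat.succ_le_succ h.le
    · exact Nat.succ_le_succ h.1.le
  · have := hpG (e j)
    rw [← himg fun q => ρ q < ρ (e j) ∧ A q ⊆ A (e j)] at this
    refine Submodule.span_mono (Set.image_mono ?_) this
    rintro m ⟨hm, hA⟩
    exact ⟨not_le.1 fun h => (he m j h).not_gt hm, hA⟩
  · refine (hspan n le_rfl i).trans ?_
    simp only [W]
    rw [← himg fun q => (q.1.2 : ℕ) < n ∧ A q ⊆ arcTimes i n]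
    refine Submodule.span_mono (Set.image_mono ?_)
    rintro m ⟨_, hA⟩ hi
    exact absurd (hA hi).1 (by simp)

end Generators

/-! ### Shrinking a trellis by relabelling the vertices of its paths -/

section Image

variable {n : ℕ} [NeZero n] {R : Type}

/-- The trellis whose vertices at time `i` are the values of `f i`, and whose edges come from the
members of `S`. -/
def imageTrellis (T : Trellis n R) (S : Set ((∀ i, T.V i) × (Fin n → R)))
    (f : ∀ i, S → T.V i) : Trellis n R where
  V i := {v : T.V i // ∃ s, f i s = v}
  finite i := by
    have := T.finite i
    infer_instance
  E i := {e | ∃ s : S, f i s = e.1.1 ∧ s.1.2 i = e.2.1 ∧ f (i + 1) s = e.2.2.1}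

/-- By `hf`, paths that fit together after relabelling already fit together in `T`, so splicing them
creates no new words. The image trellis thus represents the same code, and minimality forbids losing
a vertex. -/
theorem surjective_of_isMinimalFor {T : Trellis n R} {C : Set (Fin n → R)}
    (hT : T.IsMinimalFor C) (f : ∀ i, T.labelCode → T.V i)
    (hf : ∀ s : Fin n → T.labelCode,
      (∀ i, f (i + 1) (s i) = f (i + 1) (s (i + 1))) →
        ∀ i, (s i).1.1 (i + 1) = (s (i + 1)).1.1 (i + 1)) (i : Fin n) :
    Function.Surjective (f i) := by
  by_contra hi
  have hcode : (imageTrellis T T.labelCode f).code = C := by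
    rw [← hT.1]
    ext c
    constructor
    · rintro ⟨v, hv⟩
      choose s hs1 hs2 hs3 using hv
      refine ⟨fun i => (s i).1.1 i, fun i => ?_⟩
      have h := hf s (fun i => (hs3 i).trans (hs1 (i + 1)).symm) i
      have h2 := (s i).2 i
      rw [h] at h2
      have h3 : (s i).1.2 i = c i := hs2 i
      rw [h3] at h2
      exact h2
    · rintro ⟨v, hv⟩
      exact ⟨fun i => ⟨_, ⟨(v, c), hv⟩, rfl⟩, fun i => ⟨⟨(v, c), hv⟩, rfl, rfl, rfl⟩⟩
  have hfin := T.finite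
  refine hT.2 ⟨_, hcode, fun i => ?_, i, ?_⟩
  · exact Nat.card_le_card_of_injective _ Subtype.val_injective
  · obtain ⟨v, hv⟩ := not_forall.1 hi
    exact Finite.card_subtype_lt hv

end Image

/-! ### Minimal linear trellises are trim and connected -/

section Linear

variable {n : ℕ} [NeZero n] {R : Type} [CommRing R] {T : Trellis n R}
  [∀ i, AddCommGroup (T.V i)] [∀ i, Module R (T.V i)]
  {S : Submodule R ((∀ i, T.V i) × (Fin n → R))} {C : Set (Fin n → R)}

theorem exists_mem_of_vertex (hS : (S : Set _) = T.labelCode) (hT : T.IsMinimalFor C) (i : Fin n)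
    (v : T.V i) : ∃ s ∈ S, s.1 i = v := by
  obtain ⟨s, rfl⟩ := surjective_of_isMinimalFor hT (fun i s => s.1.1 i) (fun _ h => h) i v
  exact ⟨s, by rw [← SetLike.mem_coe, hS]; exact s.2, rfl⟩

/-- A minimal linear trellis is connected: its paths are sums of paths through a zero vertex. -/
theorem le_iSup_arcPaths (hS : (S : Set _) = T.labelCode) (hT : T.IsMinimalFor C) :
    S ≤ ⨆ a, arcPaths S a n := by
  set U := ⨆ a, arcPaths S a n with hU
  have hmem : ∀ s, s ∈ T.labelCode ↔ s ∈ S := fun s => by rw [← hS]; rfl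
  have hUS : U ≤ S := iSup_le fun a => arcPaths_le S a n
  let rep : (∀ i, T.V i) × (Fin n → R) → (∀ i, T.V i) × (Fin n → R) :=
    fun s => (Submodule.Quotient.mk (p := U) s).out
  have hrep : ∀ s, s - rep s ∈ U := fun s =>
    (Submodule.Quotient.eq U).1 (Quotient.out_eq' _).symm
  have hrep' : ∀ s s', s - s' ∈ U → rep s = rep s' := fun s s' h =>
    congrArg Quotient.out ((Submodule.Quotient.eq U).2 h)
  -- Only the vertex at time `0` is changed, by subtracting that of the representative modulo `U`.
  -- Paths that share a vertex at another time differ by an element of `U`. So the paths of a round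
  -- all have the same representative, which cancels at time `0`.
  let f : ∀ i, T.labelCode → T.V i := fun i s =>
    s.1.1 i - if i = 0 then (rep s).1 i else 0
  have hf := surjective_of_isMinimalFor hT f (fun s hs => by
    have h1 : ∀ i, i + 1 ≠ 0 → rep (s i) = rep (s (i + 1)) := by
      intro i hi
      have h2 := hs i
      simp only [f, if_neg hi, sub_zero] at h2
      refine hrep' _ _ (le_iSup (fun a => arcPaths S a n) (i + 1) ?_)
      refine (mem_arcPaths_length S).2 ⟨S.sub_mem ((hmem _).1 (s i).2) ((hmem _).1 (s _).2), ?_⟩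
      exact sub_eq_zero.2 h2
    have h3 : ∀ k (hk : k < n), rep (s ⟨k, hk⟩) = rep (s 0) := by
      intro k
      induction k with
      | zero => intro _; rfl
      | succ k ih =>
        intro hk
        have h4 : (⟨k + 1, hk⟩ : Fin n) = ⟨k, by omega⟩ + 1 := by
          refine Fin.ext ?_
          rw [Fin.val_add, Fin.val_one', Nat.add_mod_mod, Nat.mod_eq_of_lt hk]
        refine (congrArg (fun i => rep (s i).1) h4).trans
          ((h1 ⟨k, by omega⟩ ?_).symm.trans (ih (by omega)))
        rw [← h4]
        intro h
        have h8 : k + 1 = ((0 : Fin n) : ℕ) := congrArg Fin.val h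
        rw [Fin.val_zero] at h8
        omega
    intro i
    have h5 := hs i
    have h6 : rep (s i) = rep (s (i + 1)) := (h3 i i.2).trans (h3 (i + 1 : Fin n) (i + 1).2).symm
    simp only [f, h6] at h5
    exact sub_left_injective h5) 0
  intro s hs
  -- Surjectivity at time `0` says that `s` shares its vertex there with `s' - rep s'`, a member of
  -- `U`.
  obtain ⟨s', hs'⟩ := hf (s.1 0)
  have h7 : s - (s'.1 - rep s'.1) ∈ U := by
    refine le_iSup (fun a => arcPaths S a n) 0 ?_
    refine (mem_arcPaths_length S).2 ⟨S.sub_mem hs (hUS (hrep _)), ?_⟩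
    change s.1 0 - (s'.1.1 0 - (rep s'.1).1 0) = 0
    rw [← hs']
    simp [f]
  simpa using U.add_mem h7 (hrep s'.1)

end Linear

/-! ### Arcs as cyclic intervals -/

section ArcEnd

variable {n : ℕ} [NeZero n]

/-- The last time of the arc of `l` edges that starts at time `a`. -/
def arcEnd (a : Fin n) (l : ℕ) : Fin n :=
  a + Fin.ofNat n (l - 1)

theorem arcEnd_sub_val {a : Fin n} {l : ℕ} (h1 : 1 ≤ l) (h2 : l ≤ n) :
    ((arcEnd a l - a : Fin n) : ℕ) = l - 1 := by
  rw [arcEnd, add_sub_cancel_left, Fin.val_ofNat, Nat.mod_eq_of_lt (by omega)]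

theorem sub_val_cases (a i : Fin n) :
    (a ≤ i ∧ ((i - a : Fin n) : ℕ) + a = i) ∨ (i < a ∧ ((i - a : Fin n) : ℕ) + a = n + i) := by
  rcases le_or_gt a i with h | h
  · refine Or.inl ⟨h, ?_⟩
    rw [Fin.sub_val_of_le h]
    have := Fin.le_def.1 h
    omega
  · refine Or.inr ⟨h, ?_⟩
    have h1 := Fin.lt_def.1 h
    rw [Fin.sub_def]
    have h2 : n - (a : ℕ) + i < n := by omega
    simp only [Nat.mod_eq_of_lt h2]
    omega

theorem cyclicIoc_arcEnd {a : Fin n} {l : ℕ} (h1 : 1 ≤ l) (h2 : l ≤ n) :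
    cyclicIoc a (arcEnd a l) = arcTimes a l := by
  have hb := arcEnd_sub_val (a := a) h1 h2
  ext i
  simp only [cyclicIoc, cyclicIcc, arcTimes, Set.mem_sdiff, Set.mem_ofPred_eq,
    Set.mem_singleton_iff]
  rw [← sub_val_eq_zero (a := a)]
  simp only [Fin.le_def, Fin.lt_def]
  have := i.isLt
  rcases sub_val_cases a i with ⟨h3, h4⟩ | ⟨h3, h4⟩ <;>
  rcases sub_val_cases a (arcEnd a l) with ⟨h5, h6⟩ | ⟨h5, h6⟩ <;>
  simp only [Fin.le_def, Fin.lt_def] at h3 h5 <;>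
  omega

end ArcEnd

/-! ### Products of elementary trellises -/

section ArcProduct

variable {n N : ℕ} [NeZero n] {R : Type} [CommRing R]

/-- The product of the elementary trellises of the words `x j`, each with the span given by its
arc. -/
def arcProduct (p : ℕ) (x : Fin N → Fin n → R) (a : Fin N → Fin n) (l : Fin N → ℕ) : Trellis n R :=
  Trellis.product fun j => elementary p (x j) (a j) (arcEnd (a j) (l j))

variable {p : ℕ} {x : Fin N → Fin n → R} {a : Fin N → Fin n} {l : Fin N → ℕ}

theorem card_vertex (hl : ∀ j, 1 ≤ l j ∧ l j ≤ n) [NeZero p] (i : Fin n)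
    [DecidablePred fun j => i ∈ arcTimes (a j) (l j)] :
    (arcProduct p x a l).profile i =
      p ^ (Finset.univ.filter fun j => i ∈ arcTimes (a j) (l j)).card := by
  have h : (arcProduct p x a l).profile i = ∏ j, if i ∈ arcTimes (a j) (l j) then p else 1 := by
    refine (Nat.card_pi (β := fun j => {v : Fin p //
      i ∉ cyclicIoc (a j) (arcEnd (a j) (l j)) → (v : ℕ) = 0})).trans ?_
    refine Finset.prod_congr rfl fun j _ => ?_
    rw [cyclicIoc_arcEnd (hl j).1 (hl j).2]
    split_ifs with hj
    · rw [Nat.card_congr (Equiv.subtypeUnivEquiv fun v h => absurd hj h), Nat.card_fin]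
    · refine Nat.card_eq_one_iff_unique.2 ⟨⟨fun v w => Subtype.ext (Fin.ext ?_)⟩,
        ⟨⟨0, fun _ => rfl⟩⟩⟩
      rw [v.2 hj, w.2 hj]
  rw [h, Finset.prod_ite, Finset.prod_const_one, mul_one, Finset.prod_const]

theorem mem_edges (hl : ∀ j, 1 ≤ l j ∧ l j ≤ n) {i : Fin n} {d : (arcProduct p x a l).V i} {c : R}
    {d' : (arcProduct p x a l).V (i + 1)} :
    (d, c, d') ∈ (arcProduct p x a l).E i ↔ ∃ m : Fin N → ℕ, (∀ j, m j < p) ∧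
      (∀ j, i ∈ arcTimes (a j) (l j) → ((d j).1 : ℕ) = m j) ∧
      (∀ j, i + 1 ∈ arcTimes (a j) (l j) → ((d' j).1 : ℕ) = m j) ∧ c = ∑ j, m j • x j i := by
  constructor
  · rintro ⟨c', h1, h2⟩
    choose m hm1 hm2 hm3 using h1
    refine ⟨fun j => m j, fun j => (m j).2, fun j hj => ?_, fun j hj => ?_, ?_⟩
    · exact congrArg Fin.val (hm1 j (by rwa [cyclicIoc_arcEnd (hl j).1 (hl j).2]))
    · exact congrArg Fin.val (hm2 j (by rwa [cyclicIoc_arcEnd (hl j).1 (hl j).2]))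
    · exact h2.trans (Finset.sum_congr rfl fun j _ => hm3 j)
  · rintro ⟨m, hm, h1, h2, h3⟩
    refine ⟨fun j => m j • x j i, fun j => ⟨⟨m j, hm j⟩, fun hj => Fin.ext (h1 j ?_),
      fun hj => Fin.ext (h2 j ?_), rfl⟩, h3⟩
    · rwa [cyclicIoc_arcEnd (hl j).1 (hl j).2] at hj
    · rwa [cyclicIoc_arcEnd (hl j).1 (hl j).2] at hj

/-- A vertex of the product, from coefficients that are cut off outside of the spans. -/
theorem exists_vertex (hl : ∀ j, 1 ≤ l j ∧ l j ≤ n) [NeZero p] (i : Fin n) (m : Fin N → ℕ)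
    (hm : ∀ j, m j < p) :
    ∃ d : (arcProduct p x a l).V i, ∀ j, i ∈ arcTimes (a j) (l j) → ((d j).1 : ℕ) = m j := by
  classical
  refine ⟨fun j => ⟨if i ∈ arcTimes (a j) (l j) then ⟨m j, hm j⟩ else 0, fun hj => ?_⟩,
    fun j hj => ?_⟩
  · rw [cyclicIoc_arcEnd (hl j).1 (hl j).2] at hj
    rw [if_neg hj]
    rfl
  · dsimp only
    rw [if_pos hj]

/-- The product of elementary trellises represents the `p`-linear combinations of the words. -/
theorem code_arcProduct [NeZero p] (hl : ∀ j, 1 ≤ l j ∧ l j ≤ n)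
    (hx : ∀ j i, l j ≤ ((i - a j : Fin n) : ℕ) → x j i = 0) :
    (arcProduct p x a l).code = pSpan p x := by
  ext c
  constructor
  · rintro ⟨v, hv⟩
    choose m hm1 hm2 hm3 hm4 using fun i => (mem_edges hl).1 (hv i)
    -- At the inner times of its arc, the vertex of a factor records the coefficient, which is
    -- therefore constant along the arc. Off the arc the coefficient is arbitrary, but the word
    -- vanishes there.
    have key : ∀ j t i, ((i - a j : Fin n) : ℕ) = t → t < l j → m i j = m (a j) j := by
      intro j t
      induction t with
      | zero =>
        intro i hi _
        rw [sub_val_eq_zero.1 hi]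
      | succ t ih =>
        intro i hi ht
        have h1 := offset_cases (a j) i
        have h2 := sub_add_one_val (a j) (i - 1)
        have h3 := add_one_sub_val (a j) (i - 1)
        rw [sub_add_cancel, hi] at h3
        have h4 := (i - 1 - a j).isLt
        have h5 : ((i - 1 - a j : Fin n) : ℕ) = t := by
          rcases Nat.lt_or_ge (((i - 1 - a j : Fin n) : ℕ) + 1) n with h6 | h6
          · rw [Nat.mod_eq_of_lt h6] at h3
            omega
          · rw [show ((i - 1 - a j : Fin n) : ℕ) + 1 = n by omega, Nat.mod_self] at h3
            omega
        rw [← ih (i - 1) h5 (by omega)]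
        have hact : i ∈ arcTimes (a j) (l j) := ⟨by omega, by omega⟩
        rw [← hm2 i j hact]
        have h7 := hm3 (i - 1) j (by rwa [sub_add_cancel])
        rw [← h7]
        exact congrArg (fun q => ((v q j).1 : ℕ)) (sub_add_cancel i 1).symm
    refine ⟨fun j => m (a j) j, fun j => hm1 _ _, funext fun i => ?_⟩
    rw [Finset.sum_apply]
    refine (hm4 i).trans (Finset.sum_congr rfl fun j _ => ?_)
    rcases Nat.lt_or_ge ((i - a j : Fin n) : ℕ) (l j) with h | h
    · rw [key j _ i rfl h]
      rfl
    · rw [Pi.smul_apply, hx j i h, smul_zero, smul_zero]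
  · rintro ⟨d, hd, rfl⟩
    choose v hv using fun i => exists_vertex (x := x) hl i d hd
    exact ⟨v, fun i => (mem_edges hl).2 ⟨d, hd, hv i, hv (i + 1), by simp⟩⟩

end ArcProduct
-- Factorization of a minimal linear trellis
section Factorization

variable {p α n N : ℕ} [Fact p.Prime] [NeZero n] {T : Trellis n (ZMod (p ^ α))}
  [∀ i, AddCommGroup (T.V i)] [∀ i, Module (ZMod (p ^ α)) (T.V i)]
  {S : Submodule (ZMod (p ^ α)) ((∀ i, T.V i) × (Fin n → ZMod (p ^ α)))}

/-- The vertex at time `i` of a combination depends only on the generators whose arc has `i` as an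
inner time, whence a map from vertices of the product onto `T.V i`. The other generators cover the
kernel `arcPaths S i n`; comparing sizes with `p ^ N ≤ |S|` makes the map bijective. -/
theorem isomorphic_arcProduct (hS : (S : Set _) = T.labelCode)
    (hV : ∀ i (v : T.V i), ∃ s ∈ S, s.1 i = v)
    {g : Fin N → (∀ i, T.V i) × (Fin n → ZMod (p ^ α))} {a : Fin N → Fin n} {l : Fin N → ℕ}
    (hl : ∀ j, 1 ≤ l j ∧ l j ≤ n) (hg : ∀ j, g j ∈ arcPaths S (a j) (l j))
    (hcov : ∀ s ∈ S, ∃ d : Fin N → ℕ, (∀ j, d j < p) ∧ s = ∑ j, d j • g j)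
    (hcov' : ∀ i, ∀ s ∈ arcPaths S i n, ∃ d : Fin N → ℕ, (∀ j, d j < p) ∧
      (∀ j, i ∈ arcTimes (a j) (l j) → d j = 0) ∧ s = ∑ j, d j • g j)
    (hN : p ^ N ≤ Nat.card S) :
    T.Isomorphic (arcProduct p (fun j => (g j).2) a l) := by
  classical
  have hfin := T.finite
  have hp : 0 < p := (Fact.out : p.Prime).pos
  have hmem : ∀ s, s ∈ T.labelCode ↔ s ∈ S := fun s => by rw [← hS]; rfl
  have hgS : ∀ j, g j ∈ S := fun j => (hg j).1
  have hg0 : ∀ i j, i ∉ arcTimes (a j) (l j) → (g j).1 i = 0 := fun i j h => ((hg j).2 i).1 h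
  have hfst : ∀ (m : Fin N → ℕ) i, (∑ j, m j • g j).1 i = ∑ j, m j • (g j).1 i := by
    intro m i
    rw [Prod.fst_sum, Finset.sum_apply]
    rfl
  have hsnd : ∀ (m : Fin N → ℕ) i, (∑ j, m j • g j).2 i = ∑ j, m j • (g j).2 i := by
    intro m i
    rw [Prod.snd_sum, Finset.sum_apply]
    rfl
  let Q := arcProduct p (fun j => (g j).2) a l
  have hQfin := Q.finite
  let ψ : ∀ i, Q.V i → T.V i := fun i d => ∑ j, ((d j).1 : ℕ) • (g j).1 i
  have hψ : ∀ i (d : Q.V i) (m : Fin N → ℕ),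
      (∀ j, i ∈ arcTimes (a j) (l j) → ((d j).1 : ℕ) = m j) →
        ψ i d = ∑ j, m j • (g j).1 i := by
    intro i d m h
    refine Finset.sum_congr rfl fun j _ => ?_
    by_cases hj : i ∈ arcTimes (a j) (l j)
    · rw [h j hj]
    · rw [hg0 i j hj, smul_zero, smul_zero]
  have hsurj : ∀ i, Function.Surjective (ψ i) := by
    intro i v
    obtain ⟨s, hs, rfl⟩ := hV i v
    obtain ⟨m, hm, rfl⟩ := hcov s hs
    obtain ⟨d, hd⟩ := exists_vertex (x := fun j => (g j).2) hl i m hm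
    exact ⟨d, (hψ i d m hd).trans (hfst m i).symm⟩
  have hcard : ∀ i, Nat.card (Q.V i) ≤ Nat.card (T.V i) := by
    intro i
    have h1 : Nat.card (Q.V i) = _ := card_vertex (x := fun j => (g j).2) (p := p) hl i
    have h2 : Nat.card (arcPaths S i n) ≤
        p ^ (Finset.univ.filter fun j => ¬ i ∈ arcTimes (a j) (l j)).card := by
      refine card_le_of_pCombinations (x := g) _ (fun j hj => ?_) fun s hs => ?_
      · exact (mem_arcPaths_length S).2 ⟨hgS j, hg0 i j (Finset.mem_filter.1 hj).2⟩
      · obtain ⟨d, hd, hd0, h⟩ := hcov' i s hs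
        refine ⟨d, hd, fun j hj => hd0 j ?_, h⟩
        by_contra h'
        exact hj (Finset.mem_filter.2 ⟨Finset.mem_univ _, h'⟩)
    have h3 : Nat.card S ≤ Nat.card (arcPaths S i n) * Nat.card (T.V i) := by
      let ev : S →ₗ[ZMod (p ^ α)] T.V i :=
        LinearMap.proj i ∘ₗ LinearMap.fst _ _ _ ∘ₗ S.subtype
      rw [← card_ker_mul_card_range ev]
      refine Nat.mul_le_mul (le_of_eq ?_) (Nat.card_le_card_of_injective _ Subtype.val_injective)
      exact Nat.card_congr ⟨fun s => ⟨s, (mem_arcPaths_length S).2 ⟨s.1.2, s.2⟩⟩,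
        fun s => ⟨⟨s, s.2.1⟩, ((mem_arcPaths_length S).1 s.2).2⟩, fun _ => rfl, fun _ => rfl⟩
    rw [h1]
    have h4 := Finset.card_filter_add_card_filter_not (s := (Finset.univ : Finset (Fin N)))
      (fun j => i ∈ arcTimes (a j) (l j))
    rw [Finset.card_fin] at h4
    rw [← h4, pow_add] at hN
    refine Nat.le_of_mul_le_mul_right ?_ (pow_pos hp
      (Finset.univ.filter fun j => ¬ i ∈ arcTimes (a j) (l j)).card)
    calc _ ≤ _ := hN.trans h3
      _ ≤ _ := Nat.mul_le_mul_right _ h2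
      _ = _ := mul_comm _ _
  have hbij : ∀ i, Function.Bijective (ψ i) := fun i =>
    (hsurj i).bijective_of_nat_card_le (hcard i)
  have hedge : ∀ i (d : Q.V i) c (d' : Q.V (i + 1)),
      (ψ i d, c, ψ (i + 1) d') ∈ T.E i ↔ (d, c, d') ∈ Q.E i := by
    intro i d c d'
    constructor
    · intro he
      -- To obtain the edge from a single combination, extend it to a cycle: go around from `i + 1`
      -- with the coefficients `d'`, and let generator `j` switch to its coefficient in `d` at its
      -- start `a j`, where its vertex is zero. `off` is the distance from `i + 1`.
      let off : Fin n → ℕ := fun τ => ((τ - (i + 1) : Fin n) : ℕ)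
      have hoff0 : off (i + 1) = 0 := sub_val_eq_zero.2 rfl
      have hoffi : off i + 1 = n := by
        rcases offset_cases i i with h | h
        · simp at h
        · exact h.2
      have hoff1 : ∀ τ, τ ≠ i → off (τ + 1) = off τ + 1 := by
        intro τ hτ
        have h1 : off τ + 1 < n := by
          rcases offset_cases i τ with h | h
          · exact h.1 ▸ h.2
          · exact absurd (sub_val_eq_zero.1 h.1) hτ
        exact (add_one_sub_val (i + 1) τ).trans (Nat.mod_eq_of_lt h1)
      let m : Fin n → Fin N → ℕ := fun τ j =>
        if off τ < off (a j) then ((d' j).1 : ℕ) else ((d j).1 : ℕ)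
      let v : ∀ τ, T.V τ := fun τ => ∑ j, m τ j • (g j).1 τ
      have hga : ∀ j τ, τ = a j → (g j).1 τ = 0 := fun j τ h =>
        hg0 _ _ (notMem_arcTimes.2 (Or.inl (sub_val_eq_zero.2 h)))
      have hoffinj : ∀ τ τ', off τ = off τ' → τ = τ' := fun τ τ' h =>
        sub_left_injective (Fin.ext h)
      have hvi : v i = ψ i d := by
        refine Finset.sum_congr rfl fun j _ => ?_
        have : ¬ off i < off (a j) := by
          have : off (a j) < n := (a j - (i + 1)).isLt
          omega
        simp only [m, if_neg this]
      have hvi' : v (i + 1) = ψ (i + 1) d' := by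
        refine Finset.sum_congr rfl fun j _ => ?_
        by_cases h : off (i + 1) < off (a j)
        · simp only [m, if_pos h]
        · have : i + 1 = a j := hoffinj _ _ (by omega)
          rw [hga j _ this, smul_zero, smul_zero]
      let s : (∀ i, T.V i) × (Fin n → ZMod (p ^ α)) :=
        (v, fun τ => if τ = i then c else ∑ j, m τ j • (g j).2 τ)
      have hs : s ∈ S := by
        refine (hmem s).1 fun τ => ?_
        by_cases hτ : τ = i
        · subst hτ
          simp only [s, if_pos, hvi, hvi']
          exact he
        · simp only [s, if_neg hτ]
          have h1 : ∑ j, m τ j • g j ∈ T.labelCode :=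
            (hmem _).2 (Submodule.sum_mem _ fun j _ => nsmul_mem (hgS j) _)
          have h2 := h1 τ
          rw [hfst, hfst, hsnd] at h2
          have h3 : v (τ + 1) = ∑ j, m τ j • (g j).1 (τ + 1) := by
            refine Finset.sum_congr rfl fun j _ => ?_
            by_cases h4 : τ + 1 = a j
            · rw [hga j _ h4, smul_zero, smul_zero]
            · have h5 : off (τ + 1) ≠ off (a j) := fun h => h4 (hoffinj _ _ h)
              have h6 := hoff1 τ hτ
              have h7 : off (τ + 1) < off (a j) ↔ off τ < off (a j) := by omega
              simp only [m, h7]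
          rw [h3]
          exact h2
      obtain ⟨e, he1, he2⟩ := hcov s hs
      obtain ⟨dd, hdd⟩ := exists_vertex (x := fun j => (g j).2) hl i e he1
      obtain ⟨dd', hdd'⟩ := exists_vertex (x := fun j => (g j).2) hl (i + 1) e he1
      have h1 : dd = d := by
        refine (hbij i).1 ((hψ i dd e hdd).trans ?_)
        rw [← hvi, ← hfst, ← he2]
      have h2 : dd' = d' := by
        refine (hbij (i + 1)).1 ((hψ (i + 1) dd' e hdd').trans ?_)
        rw [← hvi', ← hfst, ← he2]
      subst h1 h2
      refine (mem_edges hl).2 ⟨e, he1, hdd, hdd', ?_⟩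
      rw [← hsnd, ← he2]
      simp [s]
    · intro he
      obtain ⟨m, hm, h1, h2, h3⟩ := (mem_edges hl).1 he
      have h4 : ∑ j, m j • g j ∈ T.labelCode :=
        (hmem _).2 (Submodule.sum_mem _ fun j _ => nsmul_mem (hgS j) _)
      have h5 := h4 i
      rw [hfst, hfst, hsnd, ← hψ i d m h1, ← hψ (i + 1) d' m h2, ← h3] at h5
      exact h5
  refine ⟨fun i => (Equiv.ofBijective (ψ i) (hbij i)).symm, fun i v c v' => ?_⟩
  rw [← hedge]
  have h : ∀ i v, ψ i ((Equiv.ofBijective (ψ i) (hbij i)).symm v) = v := fun i v =>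
    (Equiv.ofBijective (ψ i) (hbij i)).apply_symm_apply v
  rw [h, h]

/-- A minimal linear trellis is a product of elementary trellises. -/
theorem exists_factorization {C : Submodule (ZMod (p ^ α)) (Fin n → ZMod (p ^ α))}
    (hS : (S : Set _) = T.labelCode)
    (hT : T.IsMinimalFor (C : Set (Fin n → ZMod (p ^ α)))) :
    ∃ (N : ℕ) (x : Fin N → Fin n → ZMod (p ^ α)) (a : Fin N → Fin n) (l : Fin N → ℕ),
      (∀ j, 1 ≤ l j ∧ l j ≤ n) ∧ (∀ j, x j ∈ C) ∧
      (∀ j i, l j ≤ ((i - a j : Fin n) : ℕ) → x j i = 0) ∧ (∀ j m, j ≤ m → l m ≤ l j) ∧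
      (∀ j, p • x j ∈ Submodule.span (ZMod (p ^ α))
        (x '' {m | j < m ∧ arcTimes (a m) (l m) ⊆ arcTimes (a j) (l j)})) ∧
      C ≤ Submodule.span (ZMod (p ^ α)) (Set.range x) ∧
      (∀ d : Fin N → ℕ, (∀ j, d j < p) → (∀ j, d j ≠ 0 → l j = 1) → ∑ j, d j • x j = 0 →
        ∀ j, d j = 0) ∧
      T.Isomorphic (arcProduct p x a l) := by
  have hfin := T.finite
  have hp : 0 < p := (Fact.out : p.Prime).pos
  have hmem : ∀ s, s ∈ T.labelCode ↔ s ∈ S := fun s => by rw [← hS]; rfl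
  have hV := exists_mem_of_vertex hS hT
  have hclosed : ∀ s : (∀ i, T.V i) × (Fin n → ZMod (p ^ α)),
      (∀ i, ∃ s' ∈ S, s'.1 i = s.1 i ∧ s'.2 i = s.2 i ∧ s'.1 (i + 1) = s.1 (i + 1)) →
        s ∈ S := by
    intro s hs
    refine (hmem s).1 fun i => ?_
    obtain ⟨s', hs', h1, h2, h3⟩ := hs i
    rw [← h1, ← h2, ← h3]
    exact (hmem s').2 hs' i
  obtain ⟨N, g, a, l, hl, hg, hanti, hpg, hspan, hN⟩ := exists_arcGenerators S hclosed hV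
  have hgS : ∀ j, g j ∈ S := fun j => (hg j).1
  have hcovD : ∀ D : Set (Fin N), (∀ j ∈ D, ∀ m, arcTimes (a m) (l m) ⊆ arcTimes (a j) (l j) →
      m ∈ D) → ∀ s ∈ Submodule.span (ZMod (p ^ α)) (g '' D), ∃ d : Fin N → ℕ, (∀ j, d j < p) ∧
        (∀ j, j ∉ D → d j = 0) ∧ s = ∑ j, d j • g j := by
    intro D hD s hs
    -- Later members must have lower rank, hence the reversal `N - j`.
    refine exists_pCombination D (fun j => N - j) g (fun j hj => ?_) hs
    refine Submodule.span_mono (Set.image_mono ?_) (hpg j)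
    rintro m ⟨hm, hA⟩
    refine ⟨hD j hj m hA, ?_⟩
    have h1 := Fin.lt_def.1 hm
    have h2 := m.isLt
    omega
  have hSspan : S ≤ Submodule.span (ZMod (p ^ α)) (g '' Set.univ) :=
    (le_iSup_arcPaths hS hT).trans (iSup_le fun i =>
      (hspan i).trans (Submodule.span_mono (Set.image_mono (Set.subset_univ _))))
  have hcov : ∀ s ∈ S, ∃ d : Fin N → ℕ, (∀ j, d j < p) ∧ s = ∑ j, d j • g j := by
    intro s hs
    obtain ⟨d, hd, _, h⟩ := hcovD Set.univ (fun _ _ _ _ => Set.mem_univ _) s (hSspan hs)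
    exact ⟨d, hd, h⟩
  have hcov' : ∀ i, ∀ s ∈ arcPaths S i n, ∃ d : Fin N → ℕ, (∀ j, d j < p) ∧
      (∀ j, i ∈ arcTimes (a j) (l j) → d j = 0) ∧ s = ∑ j, d j • g j := by
    intro i s hs
    obtain ⟨d, hd, hd0, h⟩ := hcovD {m | i ∉ arcTimes (a m) (l m)}
      (fun j hj m hA hm => hj (hA hm)) s (hspan i hs)
    exact ⟨d, hd, fun j hj => hd0 j fun h => h hj, h⟩
  have huniq : PUnique p g := pUnique_of_card_le hgS hcov (by rwa [Fintype.card_fin])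
  let π : (∀ i, T.V i) × (Fin n → ZMod (p ^ α)) →ₗ[ZMod (p ^ α)] (Fin n → ZMod (p ^ α)) :=
    LinearMap.snd _ _ _
  have hπ : ∀ s ∈ S, s.2 ∈ C := fun s hs => by
    rw [← SetLike.mem_coe, ← hT.1]
    exact ⟨s.1, (hmem s).2 hs⟩
  have himg : ∀ D : Set (Fin N), (fun j => (g j).2) '' D = π '' (g '' D) := fun D => by
    rw [Set.image_image]
    rfl
  refine ⟨N, fun j => (g j).2, a, l, hl, fun j => hπ _ (hgS j),
    fun j i h => ((hg j).2 i).2 h, hanti, fun j => ?_, fun c hc => ?_,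
    fun d hd hd1 h => ?_, isomorphic_arcProduct hS hV hl hg hcov hcov' hN⟩
  · rw [himg, ← Submodule.map_span]
    exact Submodule.mem_map_of_mem (f := π) (hpg j)
  · rw [← SetLike.mem_coe, ← hT.1] at hc
    obtain ⟨v, hv⟩ := hc
    rw [← Set.image_univ, himg, ← Submodule.map_span]
    exact Submodule.mem_map_of_mem (f := π) (hSspan ((hmem _).1 hv))
  -- A generator on an arc of one edge has only zero vertices, so here a relation between labels is
  -- a relation between paths.
  · have h0 : ∑ j, d j • g j = ∑ j, (0 : Fin N → ℕ) j • g j := by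
      simp only [Pi.zero_apply, zero_smul, Finset.sum_const_zero]
      refine Prod.ext (funext fun i => ?_) ?_
      · rw [Prod.fst_sum, Finset.sum_apply]
        refine Finset.sum_eq_zero fun j _ => ?_
        by_cases hj : d j = 0
        · rw [hj, zero_smul]
          rfl
        · have : (g j).1 i = 0 := ((hg j).2 i).1 (notMem_arcTimes.2 (by rw [hd1 j hj]; omega))
          change d j • (g j).1 i = 0
          rw [this, smul_zero]
      · rw [Prod.snd_sum]
        exact h
    exact congrFun (huniq d 0 hd (fun _ => hp) h0)

end Factorization

/-! ### `p`-generator sequences and uniqueness of `p`-linear combinations -/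

section PIndependence

variable {p α k : ℕ} [Fact p.Prime] {M : Type} [AddCommGroup M] [Module (ZMod (p ^ α)) M]
  {v : Fin k → M}

theorem span_image_mono {ι : Type} {x : ι → M} {D D' : Set ι} (h : ∀ m, m ∈ D → m ∈ D') :
    Submodule.span (ZMod (p ^ α)) (x '' D) ≤ Submodule.span (ZMod (p ^ α)) (x '' D') :=
  Submodule.span_mono (Set.image_mono h)

theorem nsmul_mem_span_image {ι : Type} {x : ι → M} {D : Set ι} {j : ι} (hj : j ∈ D) (c : ℕ) :
    c • x j ∈ Submodule.span (ZMod (p ^ α)) (x '' D) :=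
  nsmul_mem (Submodule.subset_span (Set.mem_image_of_mem x hj)) c

theorem exists_pCombination_of_lt
    (h : ∀ i, p • v i ∈ Submodule.span (ZMod (p ^ α)) (v '' {m | i < m})) (D : Set (Fin k))
    (hD : ∀ i ∈ D, ∀ m, i < m → m ∈ D) {y : M}
    (hy : y ∈ Submodule.span (ZMod (p ^ α)) (v '' D)) :
    ∃ d : Fin k → ℕ, (∀ j, d j < p) ∧ (∀ j, j ∉ D → d j = 0) ∧ y = ∑ j, d j • v j := by
  refine exists_pCombination D (fun j => k - j) v (fun i hi => ?_) hy
  refine span_image_mono ?_ (h i)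
  refine fun m hm => ⟨hD i hi m hm, ?_⟩
  have h1 : (i : ℕ) < m := hm
  have h2 := m.isLt
  omega

theorem nsmul_mem_span_of_isPGeneratorSequence (h : IsPGeneratorSequence p v) (i : Fin k) :
    p • v i ∈ Submodule.span (ZMod (p ^ α)) (v '' {m | i < m}) := by
  obtain ⟨d, _, h2⟩ := h i
  rw [h2]
  exact Submodule.sum_mem _ fun j hj =>
    nsmul_mem_span_image (D := {m | i < m}) (Finset.mem_Ioi.1 hj) _

theorem isPGeneratorSequence_of_nsmul_mem_span
    (h : ∀ i, p • v i ∈ Submodule.span (ZMod (p ^ α)) (v '' {m | i < m})) :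
    IsPGeneratorSequence p v := by
  intro i
  obtain ⟨d, h1, h2, h3⟩ := exists_pCombination_of_lt h {m | i < m}
    (fun _ hj _ hm => lt_trans hj hm) (h i)
  refine ⟨d, h1, h3.trans (Finset.sum_subset (Finset.subset_univ _) fun j _ hj => ?_).symm⟩
  rw [h2 j fun h => hj (Finset.mem_Ioi.2 h), zero_smul]

/-- For a `p`-generator sequence, uniqueness of `p`-linear combinations has to be checked only
for `0`. -/
theorem pUnique_of_sum_eq_zero
    (h : ∀ i, p • v i ∈ Submodule.span (ZMod (p ^ α)) (v '' {m | i < m}))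
    (h0 : ∀ d : Fin k → ℕ, (∀ j, d j < p) → ∑ j, d j • v j = 0 → ∀ j, d j = 0) :
    PUnique p v := by
  classical
  have hp : 1 < p := (Fact.out : p.Prime).one_lt
  -- Otherwise `-v i` is a `p`-linear combination of later members, and adding `v i` to it gives a
  -- nontrivial relation.
  have hnot : ∀ i, v i ∉ Submodule.span (ZMod (p ^ α)) (v '' {m | i < m}) := by
    intro i hi
    obtain ⟨d, h1, h2, h3⟩ := exists_pCombination_of_lt h {m | i < m}
      (fun _ hj _ hm => lt_trans hj hm) (Submodule.neg_mem _ hi)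
    have h4 := h0 (d + Pi.single i 1) (fun j => ?_) ?_ i
    · simp at h4
    · by_cases hj : j = i
      · subst hj
        simp [h2 j (lt_irrefl j), hp]
      · simp [hj, h1 j]
    · simp only [Pi.add_apply, add_smul, Finset.sum_add_distrib, ← h3]
      rw [Finset.sum_eq_single i (fun j _ hj => by simp [hj]) (by simp)]
      simp
  -- At the first index where the coefficients differ, a multiple of `v i` prime to `p` is spanned
  -- by later members, hence so is `v i`.
  have key : ∀ d e : Fin k → ℕ, (∀ j, d j < p) → ∑ j, d j • v j = ∑ j, e j • v j →
      ∀ i, (∀ j < i, d j = e j) → ¬ e i < d i := by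
    intro d e hd hde i hlt hi
    refine hnot i (mem_of_nsmul_mem (d := d i - e i) (by omega)
      (lt_of_le_of_lt (Nat.sub_le _ _) (hd i)) ?_)
    have h1 : ∀ f : Fin k → ℕ, ∑ j, f j • v j = f i • v i + ∑ j ∈ Finset.univ.erase i, f j • v j :=
      fun f => (Finset.add_sum_erase _ _ (Finset.mem_univ i)).symm
    have h2 : (d i - e i) • v i =
        ∑ j ∈ Finset.univ.erase i, (e j • v j - d j • v j) := by
      rw [Finset.sum_sub_distrib, eq_sub_iff_add_eq]
      rw [h1 d, h1 e, ← Nat.sub_add_cancel hi.le, add_smul] at hde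
      refine add_left_cancel (a := e i • v i) ?_
      rw [← hde]
      abel
    rw [h2]
    refine Submodule.sum_mem _ fun j hj => ?_
    rcases lt_or_gt_of_ne (Finset.ne_of_mem_erase hj) with h3 | h3
    · rw [hlt j h3, sub_self]
      exact Submodule.zero_mem _
    · have h4 : v j ∈ Submodule.span (ZMod (p ^ α)) (v '' {m | i < m}) :=
        Submodule.subset_span ⟨j, h3, rfl⟩
      exact Submodule.sub_mem _ (nsmul_mem h4 _) (nsmul_mem h4 _)
  intro d e hd he hde
  funext i
  induction i using WellFoundedLT.induction with
  | ind i ih =>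
    exact le_antisymm (not_lt.1 (key d e hd hde i ih))
      (not_lt.1 (key e d he hde.symm i fun j hj => (ih j hj).symm))

/-- A representation of `x i` by members of `D` would be a second one besides the trivial
representation. -/
theorem notMem_span_of_pUnique {ι : Type} [Fintype ι] {x : ι → M} (hx : PUnique p x)
    {D : Set ι} (ρ : ι → ℕ)
    (h : ∀ i ∈ D, p • x i ∈ Submodule.span (ZMod (p ^ α)) (x '' {m | m ∈ D ∧ ρ m < ρ i}))
    {i : ι} (hi : i ∉ D) : x i ∉ Submodule.span (ZMod (p ^ α)) (x '' D) := by
  classical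
  intro hmem
  have hp : 1 < p := (Fact.out : p.Prime).one_lt
  obtain ⟨d, h1, h2, h3⟩ := exists_pCombination D ρ x h hmem
  have h4 := hx (Pi.single i 1) d (fun j => ?_) h1 ?_
  · have := congrFun h4 i
    rw [h2 i hi, Pi.single_eq_same] at this
    exact one_ne_zero this
  · by_cases hj : j = i
    · subst hj
      simp [hp]
    · simp [hj]
      omega
  · rw [← h3, Finset.sum_eq_single i (fun j _ hj => by simp [hj]) (by simp)]
    simp

end PIndependence

/-! ### Words supported on arcs -/

section ArcCode

variable {n : ℕ} [NeZero n] {R : Type} [CommRing R]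

/-- The members of `C` that vanish outside of the arc of length `l` that starts at `a`. -/
def arcCode (C : Submodule R (Fin n → R)) (a : Fin n) (l : ℕ) : Submodule R (Fin n → R) where
  carrier := {x | x ∈ C ∧ ∀ i, l ≤ ((i - a : Fin n) : ℕ) → x i = 0}
  add_mem' := by
    rintro x y ⟨h1, h2⟩ ⟨h3, h4⟩
    exact ⟨C.add_mem h1 h3, fun i hi => by simp [h2 i hi, h4 i hi]⟩
  zero_mem' := ⟨C.zero_mem, by simp⟩
  smul_mem' := by
    rintro c x ⟨h1, h2⟩
    exact ⟨C.smul_mem c h1, fun i hi => by simp [h2 i hi]⟩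

variable {C : Submodule R (Fin n → R)}

theorem arcCode_mono (a : Fin n) {l l' : ℕ} (h : l ≤ l') : arcCode C a l ≤ arcCode C a l' :=
  fun _ hx => ⟨hx.1, fun i hi => hx.2 i (h.trans hi)⟩

theorem eq_zero_of_mem_arcCode_zero {a : Fin n} {x : Fin n → R} (hx : x ∈ arcCode C a 0) :
    x = 0 :=
  funext fun i => hx.2 i (Nat.zero_le _)

theorem mem_arcCode_succ {a : Fin n} {l : ℕ} {x : Fin n → R}
    (hx : x ∈ arcCode C a l) (h0 : x a = 0) : x ∈ arcCode C (a + 1) (l - 1) := by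
  refine ⟨hx.1, fun i hi => ?_⟩
  rcases offset_cases a i with h | h
  · exact hx.2 i (by omega)
  · rw [sub_val_eq_zero.1 h.1, h0]

theorem mem_arcCode_pred {a : Fin n} {l : ℕ} (hl : 1 ≤ l) (hl' : l ≤ n) {x : Fin n → R}
    (hx : x ∈ arcCode C a l) (h0 : x (arcEnd a l) = 0) : x ∈ arcCode C a (l - 1) := by
  refine ⟨hx.1, fun i hi => ?_⟩
  by_cases h : l ≤ ((i - a : Fin n) : ℕ)
  · exact hx.2 i h
  · have h1 := arcEnd_sub_val (a := a) hl hl'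
    have h2 : i = arcEnd a l := by
      refine sub_left_injective (b := a) (Fin.ext ?_)
      change ((i - a : Fin n) : ℕ) = ((arcEnd a l - a : Fin n) : ℕ)
      omega
    rw [h2, h0]

theorem add_one_mem_arcTimes {a : Fin n} {l : ℕ} (h : 2 ≤ l) (hl : l ≤ n) :
    a + 1 ∈ arcTimes a l := by
  have h1 := add_one_sub_val a a
  rw [sub_val_eq_zero.2 rfl, Nat.zero_add, Nat.mod_eq_of_lt (by omega)] at h1
  exact ⟨by omega, by omega⟩

theorem arcEnd_mem_arcTimes {a : Fin n} {l : ℕ} (h : 2 ≤ l) (hl : l ≤ n) :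
    arcEnd a l ∈ arcTimes a l := by
  have h1 := arcEnd_sub_val (a := a) (by omega) hl
  exact ⟨by omega, by omega⟩

end ArcCode

/-! ### Exchange arguments for minimal families of words with arcs -/

section Reduction

variable {p α n N : ℕ} [Fact p.Prime] [NeZero n]

/-- A family of words of `C` with arcs that have the properties of a factorization of a minimal
linear trellis into elementary trellises. -/
structure IsMinimalArcFamily (C : Submodule (ZMod (p ^ α)) (Fin n → ZMod (p ^ α)))
    (x : Fin N → Fin n → ZMod (p ^ α)) (a : Fin N → Fin n) (l : Fin N → ℕ) : Prop where
  length : ∀ j, 1 ≤ l j ∧ l j ≤ n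
  mem : ∀ j, x j ∈ arcCode C (a j) (l j)
  antitone : ∀ j m, j ≤ m → l m ≤ l j
  nsmul_mem_span : ∀ j, p • x j ∈ Submodule.span (ZMod (p ^ α))
    (x '' {m | j < m ∧ arcTimes (a m) (l m) ⊆ arcTimes (a j) (l j)})
  le_span : C ≤ Submodule.span (ZMod (p ^ α)) (Set.range x)
  eq_zero_of_length : ∀ d : Fin N → ℕ, (∀ j, d j < p) → (∀ j, d j ≠ 0 → l j = 1) →
    ∑ j, d j • x j = 0 → ∀ j, d j = 0
  minimal : ∀ (x' : Fin N → Fin n → ZMod (p ^ α)) (a' : Fin N → Fin n) (l' : Fin N → ℕ),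
    (∀ j, 1 ≤ l' j ∧ l' j ≤ n) → (∀ j, x' j ∈ arcCode C (a' j) (l' j)) →
    (∀ y ∈ C, ∃ d : Fin N → ℕ, (∀ j, d j < p) ∧ y = ∑ j, d j • x' j) →
    (∀ j, arcTimes (a' j) (l' j) ⊆ arcTimes (a j) (l j)) →
    ∀ j, arcTimes (a j) (l j) ⊆ arcTimes (a' j) (l' j)

variable {C : Submodule (ZMod (p ^ α)) (Fin n → ZMod (p ^ α))}
  {x : Fin N → Fin n → ZMod (p ^ α)} {a : Fin N → Fin n} {l : Fin N → ℕ}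

namespace IsMinimalArcFamily

variable (H : IsMinimalArcFamily C x a l)
include H

theorem nsmul_mem_span_lt (j : Fin N) :
    p • x j ∈ Submodule.span (ZMod (p ^ α)) (x '' {m | j < m}) :=
  span_image_mono (fun _ h => h.1) (H.nsmul_mem_span j)

/-- A member of the family cannot be replaced by a word on a proper subarc. -/
theorem arcTimes_subset_of_replace (ρ : Fin N → ℕ)
    (hρ : ∀ j, p • x j ∈ Submodule.span (ZMod (p ^ α)) (x '' {m | ρ m < ρ j}))
    {i : Fin N} {y : Fin n → ZMod (p ^ α)} {b : Fin n} {m : ℕ} (hm : 1 ≤ m ∧ m ≤ n)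
    (hy : y ∈ arcCode C b m) (hsub : arcTimes b m ⊆ arcTimes (a i) (l i))
    (h1 : y ∈ Submodule.span (ZMod (p ^ α)) {x i} ⊔
      Submodule.span (ZMod (p ^ α)) (x '' {m | ρ m < ρ i}))
    (h2 : x i ∈ Submodule.span (ZMod (p ^ α)) {y} ⊔
      Submodule.span (ZMod (p ^ α)) (x '' {m | ρ m < ρ i})) :
    arcTimes (a i) (l i) ⊆ arcTimes b m := by
  classical
  let x' := Function.update x i y
  have hx' : ∀ j, j ≠ i → x' j = x j := fun j hj => Function.update_of_ne hj _ _
  have hxi : x' i = y := Function.update_self _ _ _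
  have hlow : Submodule.span (ZMod (p ^ α)) (x '' {m | ρ m < ρ i}) ≤
      Submodule.span (ZMod (p ^ α)) (x' '' {m | ρ m < ρ i}) := by
    refine Submodule.span_le.2 ?_
    rintro _ ⟨m, hm, rfl⟩
    refine Submodule.subset_span ⟨m, hm, hx' m ?_⟩
    rintro rfl
    exact lt_irrefl (ρ m) hm
  have hle : ∀ D : Set (Fin N), (i ∈ D → ∀ m, ρ m < ρ i → m ∈ D) →
      Submodule.span (ZMod (p ^ α)) (x '' D) ≤ Submodule.span (ZMod (p ^ α)) (x' '' D) := by
    intro D hD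
    refine Submodule.span_le.2 ?_
    rintro _ ⟨m, hm, rfl⟩
    by_cases hmi : m = i
    · subst hmi
      refine SetLike.le_def.1 (sup_le ?_ ?_) h2
      · refine Submodule.span_mono ?_
        rintro _ rfl
        exact ⟨m, hm, hxi⟩
      · exact hlow.trans (span_image_mono fun q hq => hD hm q hq)
    · exact Submodule.subset_span ⟨m, hm, hx' m hmi⟩
  -- As `y` is a multiple of `x i` plus terms of lower rank, the new family is still triangular, and
  -- its `p`-linear combinations still cover `C`.
  have hp' : ∀ j, p • x' j ∈ Submodule.span (ZMod (p ^ α)) (x' '' {m | ρ m < ρ j}) := by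
    intro j
    refine hle _ (fun h m hm => lt_trans hm h) ?_
    by_cases hj : j = i
    · subst hj
      rw [hxi]
      obtain ⟨u, hu, w, hw, rfl⟩ := Submodule.mem_sup.1 h1
      obtain ⟨c, rfl⟩ := Submodule.mem_span_singleton.1 hu
      rw [smul_add, smul_comm]
      exact Submodule.add_mem _ (Submodule.smul_mem _ _ (hρ j)) (nsmul_mem hw _)
    · rw [hx' j hj]
      exact hρ j
  have := H.minimal x' (Function.update a i b) (Function.update l i m) (fun j => ?_) (fun j => ?_)
    (fun z hz => ?_) (fun j => ?_) i
  · simpa using this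
  · by_cases hj : j = i
    · subst hj
      simpa using hm
    · simpa [hj] using H.length j
  · by_cases hj : j = i
    · subst hj
      rw [hxi]
      simpa using hy
    · rw [hx' j hj]
      simpa [hj] using H.mem j
  · have hz' : z ∈ Submodule.span (ZMod (p ^ α)) (x' '' Set.univ) := by
      refine hle _ (fun _ _ _ => Set.mem_univ _) ?_
      rw [Set.image_univ]
      exact H.le_span hz
    obtain ⟨d, hd, _, h⟩ := exists_pCombination Set.univ ρ x'
      (fun j _ => by simpa using hp' j) hz'
    exact ⟨d, hd, h⟩
  · by_cases hj : j = i
    · subst hj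
      simpa using hsub
    · simp [hj]

theorem nsmul_mem_span_rank (j : Fin N) :
    p • x j ∈ Submodule.span (ZMod (p ^ α))
      (x '' {m | N - (m : ℕ) < N - (j : ℕ)}) := by
  refine span_image_mono ?_ (H.nsmul_mem_span_lt j)
  intro m hm
  have h1 : (j : ℕ) < m := hm
  have h2 := m.isLt
  change N - (m : ℕ) < N - (j : ℕ)
  omega

/-- The first member with nonzero coefficient in a relation is spanned by later ones, so `0` could
replace it. This forces its arc to have length one; lengths decrease, so the relation involves only
arcs of length one, where independence is known. -/
theorem eq_zero_of_sum (d : Fin N → ℕ) (hd : ∀ j, d j < p) (hsum : ∑ j, d j • x j = 0) :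
    ∀ j, d j = 0 := by
  classical
  by_contra hne
  have hex : (Finset.univ.filter fun j => d j ≠ 0).Nonempty := by
    obtain ⟨j, hj⟩ := not_forall.1 hne
    exact ⟨j, by simpa using hj⟩
  obtain ⟨i, hi, hmin⟩ := Finset.exists_minimal hex
  rw [Finset.mem_filter] at hi
  have hmin' : ∀ j, d j ≠ 0 → i ≤ j := fun j hj =>
    le_of_not_gt fun hlt => absurd (hmin (Finset.mem_filter.2 ⟨Finset.mem_univ j, hj⟩) hlt.le)
      (not_le.2 hlt)
  have hxi : x i ∈ Submodule.span (ZMod (p ^ α)) (x '' {m | N - (m : ℕ) < N - (i : ℕ)}) := by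
    refine mem_of_nsmul_mem hi.2 (hd i) ?_
    rw [← Finset.add_sum_erase _ _ (Finset.mem_univ i)] at hsum
    rw [eq_neg_of_add_eq_zero_left hsum]
    refine Submodule.neg_mem _ (Submodule.sum_mem _ fun j hj => ?_)
    by_cases h0 : d j = 0
    · rw [h0, zero_smul]
      exact Submodule.zero_mem _
    · refine nsmul_mem_span_image ?_ _
      have h1 : (i : ℕ) < j := lt_of_le_of_ne (hmin' j h0) fun h =>
        Finset.ne_of_mem_erase hj (Fin.ext h.symm)
      have h2 := j.isLt
      change N - (j : ℕ) < N - (i : ℕ)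
      omega
  have hempty : arcTimes (a i) 1 = ∅ := by
    ext t
    refine ⟨fun h => ?_, fun h => h.elim⟩
    have h1 := h.1
    have h2 := h.2
    omega
  have hli : l i = 1 := by
    by_contra hli
    have := H.arcTimes_subset_of_replace (fun j => N - j) H.nsmul_mem_span_rank
      (i := i) (y := 0) (b := a i) (m := 1) ⟨le_rfl, NeZero.one_le⟩ (Submodule.zero_mem _)
      (by rw [hempty]; exact Set.empty_subset _) (Submodule.zero_mem _)
      (Submodule.mem_sup_right hxi)
    rw [hempty] at this
    have hl := H.length i
    exact this (add_one_mem_arcTimes (by omega) hl.2)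
  refine hne (H.eq_zero_of_length d hd (fun j hj => ?_) hsum)
  have h1 := H.antitone i j (hmin' j hj)
  have h2 := H.length j
  omega

theorem pUnique : PUnique p x :=
  pUnique_of_sum_eq_zero H.nsmul_mem_span_lt H.eq_zero_of_sum

theorem pLinearlyIndependent : PLinearlyIndependent p x :=
  ⟨isPGeneratorSequence_of_nsmul_mem_span H.nsmul_mem_span_lt, H.eq_zero_of_sum⟩

theorem exists_pCombination {y : Fin n → ZMod (p ^ α)} (hy : y ∈ C) :
    ∃ d : Fin N → ℕ, (∀ j, d j < p) ∧ y = ∑ j, d j • x j := by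
  obtain ⟨d, hd, _, h⟩ := exists_pCombination_of_lt H.nsmul_mem_span_lt Set.univ
    (fun _ _ _ _ => Set.mem_univ _) (y := y) (by rw [Set.image_univ]; exact H.le_span hy)
  exact ⟨d, hd, h⟩

/-- A word on a proper subarc of the arc of a member is spanned by the members whose arcs do not
contain that arc. -/
theorem mem_span_of_arcTimes_ssubset {j : Fin N} {y : Fin n → ZMod (p ^ α)} {b : Fin n} {m : ℕ}
    (hm : 1 ≤ m ∧ m ≤ n) (hy : y ∈ arcCode C b m)
    (hsub : arcTimes b m ⊂ arcTimes (a j) (l j)) :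
    y ∈ Submodule.span (ZMod (p ^ α))
      (x '' {i | ¬ arcTimes (a j) (l j) ⊆ arcTimes (a i) (l i)}) := by
  classical
  by_contra hnot
  obtain ⟨d, hd, hyd⟩ := H.exists_pCombination hy.1
  let B : Set (Fin N) := {i | arcTimes (a j) (l j) ⊆ arcTimes (a i) (l i)}
  have hex : (Finset.univ.filter fun i => i ∈ B ∧ d i ≠ 0).Nonempty := by
    by_contra hemp
    refine hnot ?_
    rw [hyd]
    refine Submodule.sum_mem _ fun i _ => ?_
    by_cases hi : i ∈ B
    · by_cases h0 : d i = 0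
      · rw [h0, zero_smul]
        exact Submodule.zero_mem _
      · exact absurd ⟨i, Finset.mem_filter.2 ⟨Finset.mem_univ i, hi, h0⟩⟩ hemp
    · exact nsmul_mem_span_image hi _
  obtain ⟨i, hi, hmin⟩ := Finset.exists_minimal hex
  rw [Finset.mem_filter] at hi
  obtain ⟨-, hiB, hdi⟩ := hi
  -- All members of `B` are ranked above all others, and within each group later members are lower.
  -- The subarc condition on `p • x q` keeps the family triangular: if the arc of `q` does not
  -- contain that of `j`, no subarc of it does.
  let ρ : Fin N → ℕ := fun q => if q ∈ B then 2 * N - q else N - q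
  have hρ : ∀ q, p • x q ∈ Submodule.span (ZMod (p ^ α)) (x '' {m | ρ m < ρ q}) := by
    intro q
    refine span_image_mono ?_ (H.nsmul_mem_span q)
    rintro r ⟨hr, hA⟩
    have h1 : (q : ℕ) < r := hr
    have h2 := r.isLt
    change ρ r < ρ q
    simp only [ρ]
    by_cases hq : q ∈ B
    · rw [if_pos hq]
      split_ifs <;> omega
    · have hr' : r ∉ B := fun h => hq (h.trans hA)
      rw [if_neg hq, if_neg hr']
      omega
  have hrest : ∑ q ∈ Finset.univ.erase i, d q • x q ∈
      Submodule.span (ZMod (p ^ α)) (x '' {m | ρ m < ρ i}) := by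
    refine Submodule.sum_mem _ fun q hq => ?_
    by_cases h0 : d q = 0
    · rw [h0, zero_smul]
      exact Submodule.zero_mem _
    refine nsmul_mem_span_image ?_ _
    have h1 := i.isLt
    have h2 := q.isLt
    change ρ q < ρ i
    simp only [ρ]
    rw [if_pos hiB]
    split_ifs with hqB
    · have h3 : ¬ q < i := fun hlt =>
        absurd (hmin (Finset.mem_filter.2 ⟨Finset.mem_univ q, hqB, h0⟩) hlt.le) (not_le.2 hlt)
      have h4 : (q : ℕ) ≠ i := fun h => Finset.ne_of_mem_erase hq (Fin.ext h)
      have h5 : ¬ (q : ℕ) < i := h3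
      omega
    · omega
  have hsum := Finset.add_sum_erase (Finset.univ : Finset (Fin N)) (fun q => d q • x q)
    (Finset.mem_univ i)
  rw [← hyd] at hsum
  -- Modulo lower ranks `y` is a multiple of `x i` prime to `p`, so `y` could replace `x i` on an
  -- arc too short to contain that of `j`.
  have := H.arcTimes_subset_of_replace ρ hρ hm hy (i := i) (hsub.subset.trans hiB) ?_ ?_
  · exact hsub.not_subset (hiB.trans this)
  · rw [← hsum]
    exact Submodule.add_mem_sup (nsmul_mem (Submodule.mem_span_singleton_self _) _) hrest
  · refine mem_of_nsmul_mem hdi (hd i) ?_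
    rw [eq_sub_of_add_eq hsum]
    exact Submodule.sub_mem _ (Submodule.mem_sup_left (Submodule.mem_span_singleton_self _))
      (Submodule.mem_sup_right hrest)

theorem ne_zero (j : Fin N) : x j ≠ 0 := by
  intro h
  refine notMem_span_of_pUnique H.pUnique (p := p) (α := α) (D := ∅) (fun _ => 0)
    (fun _ h => absurd h id)
    (i := j) id ?_
  rw [h]
  exact Submodule.zero_mem _

/-- The members of the family do not split into words on shorter arcs. -/
theorem notMem_sup (j : Fin N) :
    x j ∉ arcCode C (a j) (l j - 1) ⊔ arcCode C (a j + 1) (l j - 1) := by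
  intro h
  obtain ⟨y, hy, z, hz, hyz⟩ := Submodule.mem_sup.1 h
  have hl := H.length j
  by_cases h1 : l j = 1
  · rw [h1] at hy hz
    refine H.ne_zero j ?_
    rw [← hyz, eq_zero_of_mem_arcCode_zero hy, eq_zero_of_mem_arcCode_zero hz, add_zero]
  have hy' := H.mem_span_of_arcTimes_ssubset (j := j) ⟨by omega, by omega⟩ hy
    ⟨arcTimes_mono _ (Nat.sub_le _ _), fun hs => by
      have h2 := (hs (arcEnd_mem_arcTimes (by omega) hl.2)).2
      rw [arcEnd_sub_val hl.1 hl.2] at h2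
      exact lt_irrefl _ h2⟩
  have hz' := H.mem_span_of_arcTimes_ssubset (j := j) ⟨by omega, by omega⟩ hz
    ⟨by
      have := arcTimes_succ_subset (a j) (l := l j - 1) (by omega)
      rwa [Nat.sub_add_cancel hl.1] at this, fun hs => by
      have h2 := (hs (add_one_mem_arcTimes (by omega) hl.2)).1
      rw [sub_val_eq_zero.2 rfl] at h2
      exact absurd h2 (by omega)⟩
  -- Both summands are spanned by members whose arcs do not contain that of `j`. This set of members
  -- excludes `j` and is closed under passing to subarcs, so uniqueness is violated.
  refine notMem_span_of_pUnique H.pUnique (fun m => N - m) (fun i hi => ?_)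
    (i := j) ?_ (by rw [← hyz]; exact Submodule.add_mem _ hy' hz')
  · refine span_image_mono ?_ (H.nsmul_mem_span i)
    rintro m ⟨hm, hA⟩
    refine ⟨fun hB => hi (hB.trans hA), ?_⟩
    have h1 : (i : ℕ) < m := hm
    have h2 := m.isLt
    omega
  · exact fun h => h subset_rfl

theorem apply_start_ne_zero (j : Fin N) : x j (a j) ≠ 0 := fun h =>
  H.notMem_sup j (Submodule.mem_sup_right (mem_arcCode_succ (H.mem j) h))

theorem apply_end_ne_zero (j : Fin N) : x j (arcEnd (a j) (l j)) ≠ 0 := fun h =>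
  H.notMem_sup j (Submodule.mem_sup_left
    (mem_arcCode_pred (H.length j).1 (H.length j).2 (H.mem j) h))

/-- No word of `C` on a shorter arc has the same start and a starting component of the same
order. -/
theorem addOrderOf_ne (j : Fin N) {m : ℕ} (hm : m < l j) {y : Fin n → ZMod (p ^ α)}
    (hy : y ∈ arcCode C (a j) m) : addOrderOf (y (a j)) ≠ addOrderOf (x j (a j)) := by
  intro h
  obtain ⟨c, hc⟩ := exists_mul_of_addOrderOf_eq h.symm
  refine H.notMem_sup j ?_
  have hy' : y ∈ arcCode C (a j) (l j - 1) := arcCode_mono _ (by omega) hy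
  -- `c • y` lives on the arc without its last edge, and `x j - c • y` on the arc without its first.
  rw [← add_sub_cancel (c • y) (x j)]
  refine Submodule.add_mem_sup (Submodule.smul_mem _ c hy') ?_
  refine mem_arcCode_succ (Submodule.sub_mem _ (H.mem j) (Submodule.smul_mem _ c
    (arcCode_mono _ (Nat.sub_le _ _) hy'))) ?_
  simp [hc]

/-- Different members with the same start have starting components of different orders. -/
theorem eq_of_start_eq {i j : Fin N} (ha : a i = a j)
    (ho : addOrderOf (x i (a i)) = addOrderOf (x j (a j))) : i = j := by
  have key : ∀ i j : Fin N, i < j → a i = a j →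
      addOrderOf (x i (a i)) = addOrderOf (x j (a j)) → False := by
    intro i j hij ha ho
    have hlen := H.antitone i j hij.le
    have hmem := H.mem j
    rw [← ha] at ho hmem
    rcases hlen.lt_or_eq with hlt | heq
    · exact H.addOrderOf_ne i hlt hmem ho.symm
    obtain ⟨c, hc⟩ := exists_mul_of_addOrderOf_eq ho
    -- For equal lengths the difference loses its first component, and it could replace `x i` on a
    -- shorter arc because `x j` comes later. If the length is one, the difference is zero.
    have hz : x i - c • x j ∈ arcCode C (a i + 1) (l i - 1) := by
      refine mem_arcCode_succ (Submodule.sub_mem _ (H.mem i)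
        (Submodule.smul_mem _ c (heq ▸ hmem))) ?_
      simp [hc]
    have hxj : x j ∈ Submodule.span (ZMod (p ^ α)) (x '' {m | N - (m : ℕ) < N - (i : ℕ)}) := by
      refine Submodule.subset_span ⟨j, ?_, rfl⟩
      have h1 : (i : ℕ) < j := hij
      have h2 := j.isLt
      change N - (j : ℕ) < N - (i : ℕ)
      omega
    have hl := H.length i
    by_cases h1 : l i = 1
    · rw [h1] at hz
      have h2 : x i = c • x j := sub_eq_zero.1 (eq_zero_of_mem_arcCode_zero hz)
      refine notMem_span_of_pUnique H.pUnique (D := {m | N - (m : ℕ) < N - (i : ℕ)})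
        (fun m => N - m) (fun q hq => ?_) (i := i) (lt_irrefl (N - (i : ℕ)))
        (by rw [h2]; exact Submodule.smul_mem _ c hxj)
      refine span_image_mono ?_ (H.nsmul_mem_span_rank q)
      exact fun m hm => ⟨Nat.lt_trans hm hq, hm⟩
    · have h2 : arcTimes (a i + 1) (l i - 1) ⊆ arcTimes (a i) (l i) := by
        have := arcTimes_succ_subset (a i) (l := l i - 1) (by omega)
        rwa [Nat.sub_add_cancel hl.1] at this
      have h3 := H.arcTimes_subset_of_replace (fun m => N - m) H.nsmul_mem_span_rank
        (i := i) ⟨by omega, by omega⟩ hz h2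
        (by
          refine Submodule.sub_mem _ (Submodule.mem_sup_left
            (Submodule.mem_span_singleton_self _)) (Submodule.mem_sup_right ?_)
          exact Submodule.smul_mem _ c hxj)
        (by
          have h4 : (x i - c • x j) + c • x j = x i := by abel
          refine (congrArg (· ∈ _) h4).mp ?_
          exact Submodule.add_mem_sup (Submodule.mem_span_singleton_self _)
            (Submodule.smul_mem _ c hxj))
      have h4 := (h3 (add_one_mem_arcTimes (by omega) hl.2)).1
      rw [sub_val_eq_zero.2 rfl] at h4
      exact absurd h4 (by omega)
  rcases lt_trichotomy i j with h | h | h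
  · exact (key i j h ha ho).elim
  · exact h
  · exact (key j i h ha.symm ho.symm).elim

theorem card_eq : Nat.card C = p ^ N := by
  rw [card_eq_of_pUnique (fun j => (H.mem j).1) (fun _ hy => H.exists_pCombination hy) H.pUnique,
    Fintype.card_fin]

end IsMinimalArcFamily

end Reduction

/-! ### From minimal trellises to minimal families -/

section MinimalTrellis

variable {p α n : ℕ} [Fact p.Prime] [NeZero n]

theorem Trellis.Isomorphic.profile_eq {A : Type} {T T' : Trellis n A} (h : T.Isomorphic T') :
    T.profile = T'.profile := by
  obtain ⟨φ, _⟩ := h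
  exact funext fun i => Nat.card_congr (φ i)

/-- A competing family on subarcs has a product trellis that represents `C` and whose profile is at
most that of `T`, with strict inequality at any inner time that is lost. -/
theorem exists_isMinimalArcFamily {T : Trellis n (ZMod (p ^ α))}
    {C : Submodule (ZMod (p ^ α)) (Fin n → ZMod (p ^ α))} (hlin : T.IsLinear)
    (hT : T.IsMinimalFor (C : Set (Fin n → ZMod (p ^ α)))) :
    ∃ (N : ℕ) (x : Fin N → Fin n → ZMod (p ^ α)) (a : Fin N → Fin n) (l : Fin N → ℕ),
      IsMinimalArcFamily C x a l ∧ T.Isomorphic (arcProduct p x a l) := by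
  classical
  obtain ⟨_, _, S, hS⟩ := hlin
  obtain ⟨N, x, a, l, hl, hx, hsupp, hanti, hpx, hspan, hone, hiso⟩ := exists_factorization hS hT
  have hp : 1 < p := (Fact.out : p.Prime).one_lt
  refine ⟨N, x, a, l, ⟨hl, fun j => ⟨hx j, hsupp j⟩, hanti, hpx, hspan, hone, ?_⟩, hiso⟩
  intro x' a' l' hl' hx' hcov hsub j i hi
  by_contra hi'
  have hcode : (arcProduct p x' a' l').code = C := by
    rw [code_arcProduct hl' fun j => (hx' j).2]
    refine Set.Subset.antisymm ?_ fun y hy => hcov y hy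
    rintro _ ⟨d, _, rfl⟩
    exact Submodule.sum_mem _ fun j _ => nsmul_mem (hx' j).1 _
  have hfilter : ∀ i, (Finset.univ.filter fun j => i ∈ arcTimes (a' j) (l' j)) ⊆
      Finset.univ.filter fun j => i ∈ arcTimes (a j) (l j) := fun i j hj =>
    Finset.mem_filter.2 ⟨Finset.mem_univ j, hsub j (Finset.mem_filter.1 hj).2⟩
  refine hT.2 ⟨_, hcode, fun i => ?_, i, ?_⟩
  · rw [hiso.profile_eq, card_vertex hl, card_vertex hl']
    exact Nat.pow_le_pow_right hp.le (Finset.card_le_card (hfilter i))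
  · rw [hiso.profile_eq, card_vertex hl, card_vertex hl']
    refine Nat.pow_lt_pow_right hp (Finset.card_lt_card ⟨hfilter i, fun h => hi' ?_⟩)
    exact (Finset.mem_filter.1 (h (Finset.mem_filter.2 ⟨Finset.mem_univ j, hi⟩))).2

theorem IsPBasis.card_eq {M : Type} [AddCommGroup M] [Module (ZMod (p ^ α)) M] {k : ℕ}
    {C : Submodule (ZMod (p ^ α)) M} {v : Fin k → M} (h : IsPBasis p (C : Set M) v) :
    Nat.card C = p ^ k := by
  have hu : PUnique p v := pUnique_of_sum_eq_zero (α := α)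
    (fun i => nsmul_mem_span_of_isPGeneratorSequence h.1.1 i) h.1.2
  have hmem : ∀ j, v j ∈ C := by
    intro j
    rw [← SetLike.mem_coe, ← h.2]
    refine ⟨Pi.single j 1, fun i => ?_, ?_⟩
    · by_cases hi : i = j
      · subst hi
        simp [(Fact.out : p.Prime).one_lt]
      · simp [hi, (Fact.out : p.Prime).pos]
    · rw [Finset.sum_eq_single j (fun i _ hi => by simp [hi]) (by simp)]
      simp
  have hcov : ∀ y ∈ C, ∃ d : Fin k → ℕ, (∀ j, d j < p) ∧ y = ∑ j, d j • v j := by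
    intro y hy
    rw [← SetLike.mem_coe, ← h.2] at hy
    exact hy
  rw [card_eq_of_pUnique hmem hcov hu, Fintype.card_fin]

end MinimalTrellis

/-! ### Biproper `p`-bases in echelon form from representatives of leading terms -/

section Echelon

variable {p α n : ℕ} [Fact p.Prime]

theorem addOrderOf_eq_pow {M : Type} [AddCommGroup M] [Module (ZMod (p ^ α)) M] (x : M) :
    ∃ r, addOrderOf x = p ^ r := by
  obtain ⟨r, _, h⟩ := (Nat.dvd_prime_pow (Fact.out : p.Prime)).1
    (addOrderOf_dvd_of_nsmul_eq_zero (pow_nsmul_eq_zero (p := p) (α := α) x))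
  exact ⟨r, h⟩

theorem StartsAt.eq {R : Type} [CommRing R] {x : Fin n → R} {s t : Fin n} (hs : StartsAt x s)
    (ht : StartsAt x t) : s = t := by
  rcases lt_trichotomy s t with h | h | h
  · exact absurd (ht.2 s h) hs.1
  · exact h
  · exact absurd (hs.2 t h) ht.1

/-- `o` is the additive order of the starting component of a word of `D` that starts at `s`. -/
def IsStart (D : Submodule (ZMod (p ^ α)) (Fin n → ZMod (p ^ α))) (s : Fin n) (o : ℕ) : Prop :=
  ∃ y ∈ D, StartsAt y s ∧ addOrderOf (y s) = o

variable {D : Submodule (ZMod (p ^ α)) (Fin n → ZMod (p ^ α))}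
  {w : Fin n → ℕ → Fin n → ZMod (p ^ α)}

/-- Elimination from the left: a leading component is a multiple of the one of the representative
with the same order, and subtracting that multiple moves the start to the right. The induction
variable `m` counts the remaining positions. -/
theorem mem_span_of_vanishing
    (hw : ∀ s o, IsStart D s o → w s o ∈ D ∧ StartsAt (w s o) s ∧ addOrderOf (w s o s) = o)
    (m t : ℕ) (hmt : m + t = n) {y : Fin n → ZMod (p ^ α)} (hy : y ∈ D)
    (h0 : ∀ i : Fin n, (i : ℕ) < t → y i = 0) :
    y ∈ Submodule.span (ZMod (p ^ α))
      ((fun q : Fin n × ℕ => w q.1 q.2) '' {q | IsStart D q.1 q.2 ∧ t ≤ (q.1 : ℕ)}) := by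
  induction m generalizing t y with
  | zero =>
    have : y = 0 := funext fun i => h0 i (by omega)
    rw [this]
    exact Submodule.zero_mem _
  | succ m ih =>
    have hmono : ∀ z ∈ D, (∀ i : Fin n, (i : ℕ) < t + 1 → z i = 0) →
        z ∈ Submodule.span (ZMod (p ^ α))
          ((fun q : Fin n × ℕ => w q.1 q.2) '' {q | IsStart D q.1 q.2 ∧ t ≤ (q.1 : ℕ)}) := by
      intro z hz hz0
      refine span_image_mono ?_ (ih (t + 1) (by omega) hz hz0)
      exact fun q hq => ⟨hq.1, (Nat.le_succ t).trans hq.2⟩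
    let s : Fin n := ⟨t, by omega⟩
    have hlt : ∀ i : Fin n, (i : ℕ) < t + 1 → i ≠ s → (i : ℕ) < t := fun i hi hne =>
      lt_of_le_of_ne (Nat.lt_succ_iff.1 hi) fun h => hne (Fin.ext h)
    by_cases hs : y s = 0
    · refine hmono y hy fun i hi => ?_
      by_cases his : i = s
      · rw [his, hs]
      · exact h0 i (hlt i hi his)
    · have hst : IsStart D s (addOrderOf (y s)) := ⟨y, hy, ⟨hs, fun i hi => h0 i hi⟩, rfl⟩
      obtain ⟨h1, h2, h3⟩ := hw s _ hst
      obtain ⟨c, hc⟩ := exists_mul_of_addOrderOf_eq h3.symm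
      rw [← sub_add_cancel y (c • w s (addOrderOf (y s)))]
      refine Submodule.add_mem _ (hmono _ (D.sub_mem hy (D.smul_mem c h1)) fun i hi => ?_)
        (Submodule.smul_mem _ c (Submodule.subset_span ⟨(s, _), ⟨hst, le_rfl⟩, rfl⟩))
      by_cases his : i = s
      · rw [his]
        simp [← hc]
      · have := hlt i hi his
        simp [h0 i this, h2.2 i this]

/-- Representatives of all starts and orders of starting components, listed in echelon form, are
a proper `p`-basis. If no other word with the same start and order ends earlier than the
representative, then the basis is biproper. -/
theorem exists_isBiproperPBasis {k : ℕ} (hk : Nat.card D = p ^ k)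
    (hw : ∀ s o, IsStart D s o → w s o ∈ D ∧ StartsAt (w s o) s ∧ addOrderOf (w s o s) = o)
    (hmin : ∀ s o e, EndsAt (w s o) e → ∀ y ∈ D, StartsAt y s → addOrderOf (y s) = o →
      ∃ i, e ≤ i ∧ y i ≠ 0) :
    ∃ v : Fin k → Fin n → ZMod (p ^ α), IsBiproperPBasis p (D : Set (Fin n → ZMod (p ^ α))) v ∧
      (∀ j, ∃ s o, IsStart D s o ∧ v j = w s o) ∧ ∀ s o, IsStart D s o → ∃ j, v j = w s o := by
  classical
  have hp := (Fact.out : p.Prime)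
  -- Lexicographic order with dual orders is the echelon order: early starts first, and high orders
  -- first at one start.
  let I : Finset (Fin n ×ₗ ℕᵒᵈ) :=
    ((Finset.univ ×ˢ Finset.range (p ^ α + 1)).filter fun q : Fin n × ℕ =>
      IsStart D q.1 q.2).image fun q => toLex (q.1, OrderDual.toDual q.2)
  have hI : ∀ q : Fin n ×ₗ ℕᵒᵈ, q ∈ I ↔ IsStart D (ofLex q).1 (OrderDual.ofDual (ofLex q).2) := by
    intro q
    constructor
    · intro hq
      obtain ⟨q', hq', rfl⟩ := Finset.mem_image.1 hq
      exact (Finset.mem_filter.1 hq').2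
    · intro hq
      refine Finset.mem_image.2 ⟨((ofLex q).1, OrderDual.ofDual (ofLex q).2),
        Finset.mem_filter.2 ⟨Finset.mem_product.2 ⟨Finset.mem_univ _, ?_⟩, hq⟩, rfl⟩
      obtain ⟨y, _, _, h⟩ := hq
      rw [Finset.mem_range, Nat.lt_succ_iff, ← h]
      exact Nat.le_of_dvd (pow_pos hp.pos α)
        (addOrderOf_dvd_of_nsmul_eq_zero (pow_nsmul_eq_zero _))
  let e := I.orderEmbOfFin rfl
  let st : Fin I.card → Fin n := fun j => (ofLex (e j)).1
  let od : Fin I.card → ℕ := fun j => OrderDual.ofDual (ofLex (e j)).2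
  let v : Fin I.card → Fin n → ZMod (p ^ α) := fun j => w (st j) (od j)
  have hst : ∀ j, IsStart D (st j) (od j) := fun j => (hI _).1 (I.orderEmbOfFin_mem rfl j)
  have hv : ∀ j, v j ∈ D ∧ StartsAt (v j) (st j) ∧ addOrderOf (v j (st j)) = od j := fun j =>
    hw _ _ (hst j)
  have hlt : ∀ i j, i < j ↔ st i < st j ∨ (st i = st j ∧ od j < od i) := by
    intro i j
    rw [← e.lt_iff_lt, Prod.Lex.lt_iff]
    rfl
  have hex : ∀ s o, IsStart D s o → ∃ j, st j = s ∧ od j = o := by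
    intro s o h
    have h1 : toLex (s, OrderDual.toDual o) ∈ Set.range e := by
      rw [Finset.range_orderEmbOfFin]
      exact (hI _).2 h
    obtain ⟨j, hj⟩ := h1
    exact ⟨j, congrArg (fun q => (ofLex q).1) hj,
      congrArg (fun q => OrderDual.ofDual (ofLex q).2) hj⟩
  have hod : ∀ j, ∃ r, od j = p ^ (r + 1) := by
    intro j
    obtain ⟨r, hr⟩ := addOrderOf_eq_pow (p := p) (α := α) (v j (st j))
    rw [(hv j).2.2] at hr
    cases r with
    | zero =>
      refine absurd ?_ (hv j).2.1.1
      rw [← AddMonoid.addOrderOf_eq_one_iff, (hv j).2.2, hr, pow_zero]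
    | succ r => exact ⟨r, hr⟩
  -- The factor `p ^ r` just fails to kill the leading component of `v i`, but it kills all later
  -- members at that position: they start later, or their leading component has smaller order.
  have hkill : ∀ i j r, i < j → od i = p ^ (r + 1) → p ^ r • v j (st i) = 0 := by
    intro i j r hij hr
    rcases (hlt i j).1 hij with h | ⟨h, h'⟩
    · rw [(hv j).2.1.2 _ h, smul_zero]
    · obtain ⟨r', hr'⟩ := hod j
      rw [hr, hr', Nat.pow_lt_pow_iff_right hp.one_lt] at h'
      rw [h]
      refine addOrderOf_dvd_iff_nsmul_eq_zero.1 ?_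
      rw [(hv j).2.2, hr']
      exact pow_dvd_pow p (by omega)
  have hnkill : ∀ i r, od i = p ^ (r + 1) → p ^ r • v i (st i) ≠ 0 := by
    intro i r hr h
    have h1 := addOrderOf_dvd_iff_nsmul_eq_zero.2 h
    rw [(hv i).2.2, hr] at h1
    exact absurd ((Nat.pow_dvd_pow_iff_le_right hp.one_lt).1 h1) (by omega)
  have hrange : ∀ t : ℕ, t ≤ n → ∀ y ∈ D, (∀ i : Fin n, (i : ℕ) < t → y i = 0) →
      y ∈ Submodule.span (ZMod (p ^ α)) (v '' {j | t ≤ (st j : ℕ)}) := by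
    intro t ht y hy h0
    refine Submodule.span_mono ?_
      (mem_span_of_vanishing hw (n - t) t (Nat.sub_add_cancel ht) hy h0)
    rintro _ ⟨⟨s, o⟩, ⟨h1, h2⟩, rfl⟩
    obtain ⟨j, rfl, rfl⟩ := hex s o h1
    exact ⟨j, h2, rfl⟩
  have hgt : ∀ i, ∀ y ∈ D, (∀ t ≤ st i, y t = 0) →
      y ∈ Submodule.span (ZMod (p ^ α)) (v '' {m | i < m}) := by
    intro i y hy h0
    refine span_image_mono ?_ (hrange (st i + 1) (st i).2 y hy fun t ht =>
      h0 t (Nat.lt_succ_iff.1 ht))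
    exact fun m hm => (hlt i m).2 (Or.inl hm)
  have hpv : ∀ i, p • v i ∈ Submodule.span (ZMod (p ^ α)) (v '' {m | i < m}) := by
    intro i
    have hD : p • v i ∈ D := nsmul_mem (hv i).1 p
    have hzero : ∀ t < st i, (p • v i) t = 0 := fun t ht => by
      rw [Pi.smul_apply, (hv i).2.1.2 t ht, smul_zero]
    by_cases h0 : (p • v i) (st i) = 0
    · refine hgt i _ hD fun t ht => ?_
      rcases ht.lt_or_eq with h | h
      · exact hzero t h
      · rw [h, h0]
    -- If `p • v i` still starts at `st i`, its leading component has smaller order, so its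
    -- representative is a later member.
    · obtain ⟨j, hj1, hj2⟩ := hex (st i) _ ⟨p • v i, hD, ⟨h0, hzero⟩, rfl⟩
      have hij : i < j := by
        refine (hlt i j).2 (Or.inr ⟨hj1.symm, ?_⟩)
        obtain ⟨r, hr⟩ := hod i
        rw [hj2, hr]
        have h1 : p ^ r • (p • v i) (st i) = 0 := by
          rw [Pi.smul_apply, smul_smul, ← pow_succ, ← hr, ← (hv i).2.2,
            addOrderOf_nsmul_eq_zero]
        exact lt_of_le_of_lt (addOrderOf_le_of_nsmul_eq_zero (pow_pos hp.pos r) h1)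
          (Nat.pow_lt_pow_right hp.one_lt (Nat.lt_succ_self r))
      have h2 := (hv j).2.2
      rw [hj1, hj2] at h2
      obtain ⟨c, hc⟩ := exists_mul_of_addOrderOf_eq h2.symm
      rw [← sub_add_cancel (p • v i) (c • v j)]
      refine Submodule.add_mem _ (hgt i _ (D.sub_mem hD (D.smul_mem c (hv j).1)) fun t ht => ?_)
        (Submodule.smul_mem _ c (Submodule.subset_span ⟨j, hij, rfl⟩))
      rcases ht.lt_or_eq with h | h
      · rw [Pi.sub_apply, hzero t h, Pi.smul_apply, (hv j).2.1.2 t (hj1 ▸ h), smul_zero, sub_zero]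
      · rw [h, Pi.sub_apply, hc, Pi.smul_apply, smul_eq_mul, sub_self]
  have hzero : ∀ d : Fin I.card → ℕ, (∀ j, d j < p) → ∑ j, d j • v j = 0 → ∀ j, d j = 0 := by
    intro d hd hsum j
    induction j using WellFoundedLT.induction with
    | ind i ih =>
      by_contra hi
      obtain ⟨r, hr⟩ := hod i
      refine hnkill i r hr ?_
      have h1 : p ^ r • (∑ j, d j • v j) (st i) = d i • (p ^ r • v i (st i)) := by
        rw [Finset.sum_apply, Finset.smul_sum, Finset.sum_eq_single i]
        · rw [Pi.smul_apply, smul_comm]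
        · intro j _ hji
          rcases lt_or_gt_of_ne hji with h | h
          · rw [ih j h, zero_smul]
            exact smul_zero _
          · rw [Pi.smul_apply, smul_comm, hkill i j r h hr, smul_zero]
        · simp
      rw [hsum] at h1
      have h2 : d i • (p ^ r • v i (st i)) ∈ (⊥ : Submodule (ZMod (p ^ α)) (ZMod (p ^ α))) := by
        rw [← h1]
        exact (Submodule.mem_bot _).2 (smul_zero _)
      exact (Submodule.mem_bot _).1 (mem_of_nsmul_mem hi (hd i) h2)
  have hspan : pSpan p v = (D : Set (Fin n → ZMod (p ^ α))) := by
    refine Set.Subset.antisymm ?_ fun y hy => ?_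
    · rintro _ ⟨d, _, rfl⟩
      exact Submodule.sum_mem _ fun j _ => nsmul_mem (hv j).1 _
    · obtain ⟨d, hd, _, h⟩ := exists_pCombination_of_lt hpv {j | 0 ≤ (st j : ℕ)}
        (fun _ _ _ _ => Nat.zero_le _) (hrange 0 (Nat.zero_le n) y hy (by simp))
      exact ⟨d, hd, h⟩
  have hbasis : IsPBasis p (D : Set (Fin n → ZMod (p ^ α))) v :=
    ⟨⟨isPGeneratorSequence_of_nsmul_mem_span hpv, hzero⟩, hspan⟩
  have hK : I.card = k := by
    have := hbasis.card_eq
    rw [hk] at this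
    exact (Nat.pow_right_injective hp.two_le this).symm
  have hassoc : ∀ x y : ZMod (p ^ α), Associated x y → addOrderOf x = addOrderOf y := by
    have key : ∀ (x : ZMod (p ^ α)) (u : (ZMod (p ^ α))ˣ), addOrderOf (x * u) ∣ addOrderOf x := by
      intro x u
      refine addOrderOf_dvd_of_nsmul_eq_zero ?_
      rw [← smul_mul_assoc, addOrderOf_nsmul_eq_zero, zero_mul]
    rintro x _ ⟨u, rfl⟩
    refine Nat.dvd_antisymm ?_ (key x u)
    have := key (x * u) u⁻¹
    rwa [mul_assoc, Units.mul_inv, mul_one] at this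
  have hproper : IsProper v := by
    intro i j hij s hi hj hA
    have h1 := hi.eq (hv i).2.1
    have h2 := hj.eq (hv j).2.1
    have h3 := hassoc _ _ hA
    have h4 := (hv i).2.2
    have h5 := (hv j).2.2
    rw [← h1] at h4
    rw [← h2] at h5
    have h6 : st i = st j := h1.symm.trans h2
    have h7 : od i = od j := by rw [← h4, ← h5, h3]
    rcases lt_or_gt_of_ne hij with h | h
    · rcases (hlt i j).1 h with h' | h'
      · exact h'.ne h6
      · exact h'.2.ne h7.symm
    · rcases (hlt j i).1 h with h' | h'
      · exact h'.ne h6.symm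
      · exact h'.2.ne h7
  have hcoproper : IsCoproper v := by
    -- If the ends are associated, subtracting a unit multiple of `v j` cancels the end of `v i`. By
    -- `hkill` the start and its order are unaffected, against `hmin`.
    have key : ∀ i j, i < j → ∀ t, EndsAt (v i) t → EndsAt (v j) t →
        ¬ Associated (v j t) (v i t) := by
      rintro i j hij t hi hj ⟨u, hu⟩
      obtain ⟨r, hr⟩ := hod i
      have hz : p ^ r • (v i - (u : ZMod (p ^ α)) • v j) (st i) = p ^ r • v i (st i) := by
        rw [Pi.sub_apply, smul_sub, Pi.smul_apply, smul_comm, hkill i j r hij hr, smul_zero,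
          sub_zero]
      have hz' : p ^ (r + 1) • (v i - (u : ZMod (p ^ α)) • v j) (st i) = 0 := by
        rw [pow_succ', mul_smul, hz, ← mul_smul, ← pow_succ', ← hr, ← (hv i).2.2,
          addOrderOf_nsmul_eq_zero]
      have hle : st i ≤ st j := by
        rcases (hlt i j).1 hij with h | h
        exacts [h.le, h.1.le]
      have hs : StartsAt (v i - (u : ZMod (p ^ α)) • v j) (st i) := by
        refine ⟨fun h => hnkill i r hr ?_, fun q hq => ?_⟩
        · rw [← hz, h, smul_zero]
        · rw [Pi.sub_apply, (hv i).2.1.2 q hq, Pi.smul_apply,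
            (hv j).2.1.2 q (hq.trans_le hle), smul_zero, sub_zero]
      have ho : addOrderOf ((v i - (u : ZMod (p ^ α)) • v j) (st i)) = od i := by
        rw [hr]
        refine addOrderOf_eq_prime_pow ?_ hz'
        rw [hz]
        exact hnkill i r hr
      obtain ⟨q, hq, hq0⟩ := hmin (st i) (od i) t hi _
        (D.sub_mem (hv i).1 (D.smul_mem _ (hv j).1)) hs ho
      refine hq0 ?_
      rcases hq.lt_or_eq with h | h
      · rw [Pi.sub_apply, hi.2 q h, Pi.smul_apply, hj.2 q h, smul_zero, sub_zero]
      · rw [← h, Pi.sub_apply, Pi.smul_apply, smul_eq_mul, mul_comm, hu, sub_self]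
    intro i j hij t hi hj hA
    rcases lt_or_gt_of_ne hij with h | h
    · exact key i j h t hi hj hA.symm
    · exact key j i h t hj hi hA
  have hech : IsRowEchelon v := by
    intro i j hij s t hs ht
    have h1 := hs.eq (hv i).2.1
    have h2 := ht.eq (hv j).2.1
    subst h1 h2
    rw [(hv i).2.2, (hv j).2.2]
    exact (hlt i j).1 hij
  subst hK
  refine ⟨v, ⟨hbasis, hproper, hcoproper, hech⟩, fun j => ⟨_, _, hst j, rfl⟩, fun s o h => ?_⟩
  obtain ⟨j, rfl, rfl⟩ := hex s o h
  exact ⟨j, rfl⟩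

end Echelon

/-! ### Characteristic generators from shortest words -/

section Characteristic

variable {p α n : ℕ} [Fact p.Prime] [NeZero n]

/-- The cyclic shift as a linear map. -/
def shiftLinear (p α : ℕ) (j : Fin n) :
    (Fin n → ZMod (p ^ α)) →ₗ[ZMod (p ^ α)] (Fin n → ZMod (p ^ α)) where
  toFun := shiftLeft j
  map_add' _ _ := rfl
  map_smul' _ _ := rfl

theorem shiftLeft_injective {R : Type} (j : Fin n) :
    Function.Injective (shiftLeft j : (Fin n → R) → Fin n → R) := by
  intro x y h
  funext i
  have := congrFun h (i - j)
  simpa [shiftLeft] using this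

theorem mem_arcCode_length {C : Submodule (ZMod (p ^ α)) (Fin n → ZMod (p ^ α))} {a : Fin n}
    {x : Fin n → ZMod (p ^ α)} (hx : x ∈ C) : x ∈ arcCode C a n :=
  ⟨hx, fun i hi => absurd (i - a).isLt (not_lt.2 hi)⟩

/-- A word whose shift starts at `s` and vanishes from `e` on lives on an arc of length `e - s`. -/
theorem mem_arcCode_of_shiftLeft {C : Submodule (ZMod (p ^ α)) (Fin n → ZMod (p ^ α))} {j s : Fin n}
    {e : ℕ} (hse : (s : ℕ) ≤ e) {x : Fin n → ZMod (p ^ α)} (hx : x ∈ C)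
    (hs : ∀ i < s, shiftLeft j x i = 0) (he : ∀ i : Fin n, e ≤ i → shiftLeft j x i = 0) :
    x ∈ arcCode C (s + j) (e - s) := by
  refine ⟨hx, fun i hi => ?_⟩
  have h1 : i - (s + j) = (i - j) - s := by abel
  rw [h1] at hi
  have h2 : x i = shiftLeft j x (i - j) := by simp [shiftLeft]
  rw [h2]
  rcases sub_val_cases s (i - j) with h | h
  · exact he _ (by omega)
  · exact hs _ h.1

theorem shiftLeft_apply_eq_zero {C : Submodule (ZMod (p ^ α)) (Fin n → ZMod (p ^ α))} {j s : Fin n}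
    {l : ℕ} {x : Fin n → ZMod (p ^ α)} (hx : x ∈ arcCode C (s + j) l) {i : Fin n}
    (hi : l ≤ ((i - s : Fin n) : ℕ)) : shiftLeft j x i = 0 := by
  refine hx.2 (i + j) ?_
  rwa [add_sub_add_right_eq_sub]

/-- There are shortest words for each start and order of the starting component, and the members
of a minimal family can be chosen among them. -/
theorem exists_shortest {C : Submodule (ZMod (p ^ α)) (Fin n → ZMod (p ^ α))} {N : ℕ}
    {x : Fin N → Fin n → ZMod (p ^ α)} {a : Fin N → Fin n} {l : Fin N → ℕ}
    (H : IsMinimalArcFamily C x a l) :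
    ∃ χ : Fin n → ℕ → Fin n → ZMod (p ^ α),
      (∀ b o, (∃ y ∈ C, addOrderOf (y b) = o) → χ b o ∈ C ∧ addOrderOf (χ b o b) = o ∧
        ∀ m, ∀ y ∈ arcCode C b m, addOrderOf (y b) = o → χ b o ∈ arcCode C b m) ∧
      ∀ j, χ (a j) (addOrderOf (x j (a j))) = x j := by
  classical
  have key : ∀ b o, ∃ z : Fin n → ZMod (p ^ α),
      ((∃ y ∈ C, addOrderOf (y b) = o) → z ∈ C ∧ addOrderOf (z b) = o ∧
        ∀ m, ∀ y ∈ arcCode C b m, addOrderOf (y b) = o → z ∈ arcCode C b m) ∧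
      ∀ j, a j = b → addOrderOf (x j (a j)) = o → z = x j := by
    intro b o
    -- At most one member has this start and order, by `eq_of_start_eq`, and it is a shortest such
    -- word by `addOrderOf_ne`.
    by_cases hj : ∃ j, a j = b ∧ addOrderOf (x j (a j)) = o
    · obtain ⟨j, rfl, rfl⟩ := hj
      refine ⟨x j, fun _ => ⟨(H.mem j).1, rfl, fun m y hy ho => ?_⟩, fun i hi ho => ?_⟩
      · refine arcCode_mono _ (not_lt.1 fun hm => ?_) (H.mem j)
        exact H.addOrderOf_ne j hm hy ho
      · exact congrArg x (H.eq_of_start_eq hi ho).symm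
    · by_cases hy : ∃ y ∈ C, addOrderOf (y b) = o
      · have hex : ∃ m, ∃ y ∈ arcCode C b m, addOrderOf (y b) = o := by
          obtain ⟨y, hy, ho⟩ := hy
          exact ⟨n, y, mem_arcCode_length hy, ho⟩
        obtain ⟨z, hz, hzo⟩ := Nat.find_spec hex
        refine ⟨z, fun _ => ⟨hz.1, hzo, fun m y hy ho => ?_⟩,
          fun j h1 h2 => absurd ⟨j, h1, h2⟩ hj⟩
        exact arcCode_mono _ (Nat.find_min' hex ⟨y, hy, ho⟩) hz
      · exact ⟨0, fun h => absurd h hy, fun j h1 h2 => absurd ⟨j, h1, h2⟩ hj⟩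
  choose χ h1 h2 using key
  exact ⟨χ, h1, fun j => h2 _ _ j rfl rfl⟩

/-- The members of a minimal family belong to a set of characteristic generators. -/
theorem exists_isCharacteristicFamily {C : Submodule (ZMod (p ^ α)) (Fin n → ZMod (p ^ α))} {N : ℕ}
    {x : Fin N → Fin n → ZMod (p ^ α)} {a : Fin N → Fin n} {l : Fin N → ℕ}
    (H : IsMinimalArcFamily C x a l) :
    ∃ Y : Fin n → Fin N → Fin n → ZMod (p ^ α),
      IsCharacteristicFamily p (C : Set (Fin n → ZMod (p ^ α))) Y ∧
      ∀ i, IsGeneratorOf Y (x i) (a i) (arcEnd (a i) (l i)) := by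
  obtain ⟨χ, hχ, hχx⟩ := exists_shortest H
  let D : Fin n → Submodule (ZMod (p ^ α)) (Fin n → ZMod (p ^ α)) := fun j =>
    C.map (shiftLinear p α j)
  have hD : ∀ j, (D j : Set (Fin n → ZMod (p ^ α))) = shiftLeft j '' C := fun j => rfl
  have hcard : ∀ j, Nat.card (D j) = p ^ N := by
    intro j
    rw [← H.card_eq]
    exact (Nat.card_congr (Submodule.equivMapOfInjective (shiftLinear p α j)
      (shiftLeft_injective j) C).toEquiv).symm
  have hstart : ∀ j s o, IsStart (D j) s o → ∃ z ∈ C, addOrderOf (z (s + j)) = o := by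
    rintro j s o ⟨_, ⟨z, hz, rfl⟩, _, ho⟩
    exact ⟨z, hz, ho⟩
  have hw : ∀ j s o, IsStart (D j) s o → shiftLeft j (χ (s + j) o) ∈ D j ∧
      StartsAt (shiftLeft j (χ (s + j) o)) s ∧
        addOrderOf (shiftLeft j (χ (s + j) o) s) = o := by
    intro j s o hso
    obtain ⟨h1, h2, h3⟩ := hχ _ _ (hstart j s o hso)
    obtain ⟨_, ⟨z, hz, rfl⟩, hs, ho⟩ := hso
    refine ⟨⟨_, h1, rfl⟩, ⟨fun h => hs.1 ?_, fun i hi => ?_⟩, h2⟩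
    · rw [← AddMonoid.addOrderOf_eq_one_iff, ho, ← h2, AddMonoid.addOrderOf_eq_one_iff]
      exact h
    -- The word `z` does not wrap around the end of the shifted time axis, so neither does the
    -- shortest word with its start and order.
    · have h4 := h3 (n - s) z (mem_arcCode_of_shiftLeft s.2.le hz hs.2
        fun i hi => absurd i.2 (not_lt.2 hi)) ho
      refine shiftLeft_apply_eq_zero h4 ?_
      rcases sub_val_cases s i with h | h
      · exact absurd hi (not_lt.2 h.1)
      · omega
  have hmin : ∀ j s o e, EndsAt (shiftLeft j (χ (s + j) o)) e → ∀ y ∈ D j, StartsAt y s →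
      addOrderOf (y s) = o → ∃ i, e ≤ i ∧ y i ≠ 0 := by
    rintro j s o e he _ ⟨z, hz, rfl⟩ hs ho
    by_contra hne
    have hzero : ∀ i, e ≤ i → shiftLeft j z i = 0 := fun i hi => by
      by_contra h
      exact hne ⟨i, hi, h⟩
    have hso : IsStart (D j) s o := ⟨_, ⟨z, hz, rfl⟩, hs, ho⟩
    have hse : s ≤ e := by
      by_contra h
      exact he.1 ((hw j s o hso).2.1.2 e (not_le.1 h))
    have h4 := (hχ _ _ (hstart j s o hso)).2.2 (e - s) z
      (mem_arcCode_of_shiftLeft hse hz hs.2 hzero) ho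
    refine he.1 (shiftLeft_apply_eq_zero h4 ?_)
    rw [Fin.sub_val_of_le hse]
  choose Y hY hYw hwY using fun j => exists_isBiproperPBasis (hcard j) (hw j) (hmin j)
  -- A generator is determined by its start and the order of its starting component alone, so the
  -- choices in different shifts agree.
  have huniq : ∀ z b b', IsGeneratorOf Y z b b' → z = χ b (addOrderOf (z b)) := by
    rintro z b b' ⟨j, m, s, e, hz, hs, _, rfl, _⟩
    obtain ⟨s', o, hso, hm⟩ := hYw j m
    obtain ⟨_, h2, h3⟩ := hw j s' o hso
    rw [← hm] at h2
    obtain rfl := hs.eq h2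
    have h4 : z = χ (s + j) o := shiftLeft_injective j (hz.trans hm)
    have h5 : addOrderOf (z (s + j)) = o := by
      rw [h4]
      exact h3
    rw [h5]
    exact h4
  refine ⟨Y, ⟨fun j => hY j, fun z z' b b' hz hz' ho _ => ?_⟩, fun i => ?_⟩
  · rw [huniq z b b' hz, huniq z' b b' hz', ho]
  · have hl := H.length i
    have hs : StartsAt (shiftLeft (a i) (x i)) 0 := by
      refine ⟨?_, fun t ht => absurd ht (Fin.not_lt_zero t)⟩
      rw [shiftLeft, zero_add]
      exact H.apply_start_ne_zero i
    have hst : IsStart (D (a i)) 0 (addOrderOf (x i (a i))) := by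
      refine ⟨_, ⟨x i, (H.mem i).1, rfl⟩, hs, ?_⟩
      change addOrderOf (x i (0 + a i)) = _
      rw [zero_add]
    -- In the shift by `a i` the word `x i` starts at position `0`, and there it is the chosen
    -- representative.
    obtain ⟨m, hm⟩ := hwY (a i) 0 _ hst
    rw [zero_add, hχx] at hm
    have hcomm : arcEnd (a i) (l i) = Fin.ofNat n (l i - 1) + a i := add_comm _ _
    refine ⟨a i, m, 0, Fin.ofNat n (l i - 1), hm.symm, hm ▸ hs, ?_, (zero_add _).symm, hcomm⟩
    rw [hm]
    refine ⟨?_, fun t ht => ?_⟩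
    · rw [shiftLeft, ← hcomm]
      exact H.apply_end_ne_zero i
    · have hmem := H.mem i
      rw [← zero_add (a i)] at hmem
      refine shiftLeft_apply_eq_zero hmem ?_
      have h1 : ((Fin.ofNat n (l i - 1) : Fin n) : ℕ) < t := ht
      rw [Fin.val_ofNat, Nat.mod_eq_of_lt (by omega)] at h1
      rw [sub_zero]
      omega

end Characteristic

end TailBiting

theorem theorem4p5 (p α n k : ℕ) [Fact p.Prime] [NeZero n]
    (C : Submodule (ZMod (p ^ α)) (Fin n → ZMod (p ^ α)))
    (hk : TailBiting.HasPDimension p (C : Set (Fin n → ZMod (p ^ α))) k)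
    (T : TailBiting.Trellis n (ZMod (p ^ α)))
    (hlin : T.IsLinear)
    (hmin : T.IsMinimalFor (C : Set (Fin n → ZMod (p ^ α)))) :
    ∃ Y : Fin n → Fin k → Fin n → ZMod (p ^ α),
      TailBiting.IsCharacteristicFamily p (C : Set (Fin n → ZMod (p ^ α))) Y ∧
      ∃ (z : Fin k → Fin n → ZMod (p ^ α)) (a b : Fin k → Fin n),
        (∀ i, TailBiting.IsGeneratorOf Y (z i) (a i) (b i)) ∧
        TailBiting.PLinearlyIndependent p z ∧
        T.Isomorphic
          (TailBiting.Trellis.product fun i => TailBiting.elementary p (z i) (a i) (b i)) := by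
  obtain ⟨v, hv⟩ := hk
  obtain ⟨N, x, a, l, H, hiso⟩ := TailBiting.exists_isMinimalArcFamily hlin hmin
  -- Both `p ^ N` and `p ^ k` are the number of words of `C`.
  have hN : N = k := by
    have h := H.card_eq
    rw [hv.card_eq] at h
    exact (Nat.pow_right_injective (Fact.out : p.Prime).two_le h).symm
  subst hN
  obtain ⟨Y, hY, hgen⟩ := TailBiting.exists_isCharacteristicFamily H
  exact ⟨Y, hY, x, a, _, hgen, H.pLinearlyIndependent, hiso⟩
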